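/- Let $\xi=(\xi_n)_{n\ge1}$ be a stationary and ergodic sequence of random variables on a probability space $(\Omega_E,\mathscr F_E,P)$ with values in the space of probability laws on $\mathbb R$. Given $\xi$, let $\mathbb P_\xi$ (with expectation $\mathbb E_\xi$) be the quenched probability under which $X_1,X_2,\dots$ are independent real random variables and $X_n$ has law $\xi_n$; put $S_0=0$ and $S_n=X_1+\dots+X_n$. Let $\mathbb E$ denote the annealed expectation, $\mathbb E(\cdot)=\int \mathbb E_\xi(\cdot)\,dP$, and let $\theta\xi=(\xi_2,\xi_3,\dots)$. Assume that $$\mathbb E_\xi(X_1)=0\ \ P\text{-a.s.},\qquad \mathbb E\big(|X_1|^{2+\epsilon}\big)<\infty\ \text{ for some }\epsilon>0,\qquad \mathbb P_\xi(X_1>0)>0\ \ P\text{-a.s.}$$ For $y\ge0$ let $\tau_y=\inf\{n>0: y+S_n\le0\}$, $U_n(\xi,y)=\mathbb E_\xi(y+S_n;\tau_y>n)$ and $U(\xi,y)=-\mathbb E_\xi(S_{\tau_y})$. For $P$-almost every $\xi$, for all $y\ge0$, we have $\tau_y<\infty$ $\mathbb P_\xi$-a.s., $\mathbb E_\xi|S_{\tau_y}|<\infty$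 and $U(\xi,y)=\lim_{n\to\infty}U_n(\xi,y)$. Moreover: 1. For every $y\ge0$, $U(\xi,y)$ is $\sigma(\xi)$-measurable, where $\sigma(\xi)=\sigma(\xi_1,\xi_2,\dots)$; and $P$-a.s., for all $y\ge0$, the quenched harmonic property holds: $$U(\xi,y)=\mathbb E_\xi\big[U(\theta\xi,y+S_1);\tau_y>1\big],$$ where the random variable $U(\theta\xi,y+S_1)1_{\{\tau_y>1\}}$ is $\mathbb P_\xi$-integrable. 2. $P$-a.s., $U(\xi,y)>0$ for all $y\ge0$, the function $y\mapsto U(\xi,y)$ is non-decreasing on $[0,\infty)$, and $$\lim_{y\to\infty}\frac{U(\xi,y)}{y}=1.$$ -/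

import Mathlib

open MeasureTheory ProbabilityTheory Filter Topology
open scoped ENNReal

/-- Realizations of an environment in time: sequences of probability laws on `ℝ`.
The entry with index `n` is the law of the `(n+1)`-st increment. -/
abbrev Env : Type := ℕ → ProbabilityMeasure ℝ

namespace Env

/-- The shift `θ`. -/
def shift (e : Env) : Env := fun n => e (n + 1)

/-- The quenched probability: the law on sequences of increments under which the increments
are independent and the increment with index `n` has law `e n`. -/
noncomputable def quenched (e : Env) : Measure (ℕ → ℝ) :=
  Measure.infinitePi (fun n => (e n : Measure ℝ))

end Env

/-- The walk `S n = x 0 + ... + x (n-1)` with increments `x`, started at `0`. -/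
def walk (n : ℕ) (x : ℕ → ℝ) : ℝ := ∑ k ∈ Finset.range n, x k

/-- `τ_y = inf {n > 0 : y + S n ≤ 0}`, with value `⊤` if there is no such `n`. -/
noncomputable def exitTime (y : ℝ) : (ℕ → ℝ) → WithTop ℕ :=
  hittingAfter (fun n x => y + walk n x) (Set.Iic 0) 1

namespace Env

/-- `U_n(e, y) = E_e[y + S n ; τ_y > n]`. -/
noncomputable def harmonicApprox (n : ℕ) (e : Env) (y : ℝ) : ℝ :=
  ∫ x in {x | (n : WithTop ℕ) < exitTime y x}, (y + walk n x) ∂(quenched e)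

/-- `U(e, y) = - E_e[S_{τ_y}]`. -/
noncomputable def harmonic (e : Env) (y : ℝ) : ℝ :=
  -∫ x, stoppedValue walk (exitTime y) x ∂(quenched e)

end Env

/-! ### The walk and its exit time -/

/-! Optional stopping gives `U_n(y) = y + E[overshoot below 0 up to time n]`, so `U_n` is
nondecreasing in `n` and at least `y`. The crux is an upper bound with constants that do not depend
on `y`.

Between times `n` and `2n` the overshoot grows only on `{τ_y > n}`, and by at most the largest jump
in that block, which is independent of this event. The `(2+ε)`-moments make the mean of that jump
`O(n^q)` with `q < 1/2` (`harmonicApprox_le_add`). Harris' inequality gives `E(y + S_n)⁺ · P(τ_y >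
n) ≤ U_n(y)` (`posMean_mul_survival_le`), and `E S_n⁺ ≥ κ√n` for large `n`, so `P(τ_y > n) ≤ U_n(y)
/ (κ√n)`. The lower bound on `E S_n⁺` comes from testing `S_n` against the Riesz product `∏ (1 + i t
φ_k)`, where `φ_k` is the centered indicator of `X_k > 0`; it uses only `E X_k⁺`.

Together, `U_{2n} ≤ (1 + A n^{-s}) U_n` for large `n`, uniformly in `y ≥ 0`. The product of these
factors along dyadic times converges, so `U_n ≤ β_j U_{2^j}` for all `n`, with `β_j → 1`.
Boundedness of `U_n` gives `P(τ_y > n) → 0` and, by monotone convergence, the limit `U`. Since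
`U_{2^j}(y) ≤ y + D_j`, also `U(y)/y → 1`. The harmonic property is the limit of the one-step
recursion for `U_n`.

The environment enters through `IsGood`: moment sums of order `n^{1+η}`, and a linear lower bound on
`∑ P(X_k > δ)`, which needs only a one-sided consequence of the maximal ergodic inequality. -/

lemma measurable_walk (n : ℕ) : Measurable (walk n) := by
  unfold walk; fun_prop

lemma walk_zero (x : ℕ → ℝ) : walk 0 x = 0 := by simp [walk]

lemma walk_succ (n : ℕ) (x : ℕ → ℝ) : walk (n + 1) x = walk n x + x n := by
  simp [walk, Finset.sum_range_succ]

lemma walk_one (x : ℕ → ℝ) : walk 1 x = x 0 := by simp [walk]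

lemma lt_exitTime_iff {n : ℕ} {y : ℝ} {x : ℕ → ℝ} :
    (n : WithTop ℕ) < exitTime y x ↔ ∀ k, 1 ≤ k → k ≤ n → 0 < y + walk k x := by
  have h := hittingAfter_le_iff (u := fun n x => y + walk n x) (s := Set.Iic 0) (n := 1)
    (i := n) (ω := x)
  rw [← not_le, exitTime]
  refine (not_congr h).trans ?_
  simp only [Set.mem_Icc, Set.mem_Iic]
  push Not
  exact ⟨fun h k h1 h2 => h k ⟨h1, h2⟩, fun h k hk => h k hk.1 hk.2⟩

lemma measurableSet_lt_exitTime (n : ℕ) (y : ℝ) :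
    MeasurableSet {x | (n : WithTop ℕ) < exitTime y x} := by
  simp only [lt_exitTime_iff, Set.ofPred_forall]
  refine MeasurableSet.iInter fun k => MeasurableSet.iInter fun _ => MeasurableSet.iInter fun _ => ?_
  exact measurableSet_lt measurable_const ((measurable_walk k).const_add y)

lemma zero_lt_exitTime (y : ℝ) (x : ℕ → ℝ) : ((0 : ℕ) : WithTop ℕ) < exitTime y x := by
  rw [lt_exitTime_iff]; intro k h1 h2; omega

lemma succ_lt_exitTime_iff {n : ℕ} {y : ℝ} {x : ℕ → ℝ} :
    ((n + 1 : ℕ) : WithTop ℕ) < exitTime y x ↔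
      (n : WithTop ℕ) < exitTime y x ∧ 0 < y + walk (n + 1) x := by
  simp only [lt_exitTime_iff]
  refine ⟨fun h => ⟨fun k h1 h2 => h k h1 (by omega), h _ (by omega) le_rfl⟩,
    fun h k h1 h2 => ?_⟩
  rcases Nat.lt_or_ge k (n + 1) with h3 | h3
  · exact h.1 k h1 (by omega)
  · obtain rfl : k = n + 1 := le_antisymm h2 h3
    exact h.2

lemma lt_exitTime_anti {m n : ℕ} (h : m ≤ n) {y : ℝ} {x : ℕ → ℝ}
    (hn : (n : WithTop ℕ) < exitTime y x) : (m : WithTop ℕ) < exitTime y x :=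
  lt_of_le_of_lt (by exact_mod_cast h) hn

lemma lt_exitTime_mono {n : ℕ} {y z : ℝ} (h : y ≤ z) {x : ℕ → ℝ}
    (hn : (n : WithTop ℕ) < exitTime y x) : (n : WithTop ℕ) < exitTime z x := by
  rw [lt_exitTime_iff] at *
  intro k h1 h2
  linarith [hn k h1 h2]

/-- On the event of survival the walk is nonnegative, including at time `0`. -/
lemma nonneg_of_lt_exitTime {n : ℕ} {y : ℝ} (hy : 0 ≤ y) {x : ℕ → ℝ}
    (hn : (n : WithTop ℕ) < exitTime y x) : 0 ≤ y + walk n x := by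
  rcases Nat.eq_zero_or_pos n with rfl | h
  · simpa [walk_zero] using hy
  · exact (lt_exitTime_iff.1 hn n h le_rfl).le

/-- Prepend an increment to a sequence of increments. -/
def consPath (a : ℝ) (x : ℕ → ℝ) : ℕ → ℝ := fun n => Nat.casesOn n a x

lemma measurable_consPath : Measurable fun p : ℝ × (ℕ → ℝ) => consPath p.1 p.2 := by
  refine measurable_pi_lambda _ fun n => ?_
  cases n with
  | zero => exact measurable_fst
  | succ n => exact (measurable_pi_apply n).comp measurable_snd

lemma walk_consPath (n : ℕ) (a : ℝ) (x : ℕ → ℝ) :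
    walk (n + 1) (consPath a x) = a + walk n x := by
  simp [walk, Finset.sum_range_succ', consPath, add_comm]

lemma succ_lt_exitTime_consPath {n : ℕ} {y a : ℝ} {x : ℕ → ℝ} :
    ((n + 1 : ℕ) : WithTop ℕ) < exitTime y (consPath a x) ↔
      0 < y + a ∧ (n : WithTop ℕ) < exitTime (y + a) x := by
  simp only [lt_exitTime_iff]
  constructor
  · intro h
    refine ⟨?_, fun k h1 h2 => ?_⟩
    · have := h 1 le_rfl (by omega)
      rwa [walk_consPath 0, walk_zero, add_zero] at this
    · have := h (k + 1) (by omega) (by omega)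
      rwa [walk_consPath, ← add_assoc] at this
  · rintro ⟨h0, h⟩ k h1 h2
    obtain ⟨k, rfl⟩ : ∃ j, k = j + 1 := ⟨k - 1, by omega⟩
    rw [walk_consPath, ← add_assoc]
    rcases Nat.eq_zero_or_pos k with rfl | hk
    · simpa [walk_zero] using h0
    · exact h k hk (by omega)

namespace Env

/-! ### The quenched law -/

instance (e : Env) : IsProbabilityMeasure e.quenched := by
  unfold quenched; infer_instance

lemma measurePreserving_eval (e : Env) (n : ℕ) :
    MeasurePreserving (fun x : ℕ → ℝ => x n) e.quenched (e n : Measure ℝ) :=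
  measurePreserving_eval_infinitePi (fun n => (e n : Measure ℝ)) n

/-- The first increment and the later ones are independent, and the latter follow the
quenched law of the shifted environment. -/
lemma quenched_eq_map_consPath (e : Env) :
    e.quenched = ((e 0 : Measure ℝ).prod e.shift.quenched).map
      (fun p => consPath p.1 p.2) := by
  symm
  refine Measure.eq_infinitePi _ fun s t ht => ?_
  classical
  have hpi : MeasurableSet (Set.pi (s : Set ℕ) t) :=
    MeasurableSet.pi s.countable_toSet fun i _ => ht i
  rw [Measure.map_apply measurable_consPath hpi]
  -- Padding by the whole line turns the cylinder into a box over a full initial block, so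
  -- coordinate `0` can be split off even if `0 ∉ s`.
  set t' : ℕ → Set ℝ := fun i => if i ∈ s then t i else Set.univ with ht'
  have ht'm : ∀ i, MeasurableSet (t' i) := fun i => by
    simp only [ht']; split_ifs
    exacts [ht i, MeasurableSet.univ]
  set N := s.sup id + 1 with hN
  have hsN : s ⊆ Finset.range (N + 1) := fun i hi => by
    have := Finset.le_sup (f := id) hi
    simp only [id] at this
    simp only [Finset.mem_range]; omega
  have hset : (fun p : ℝ × (ℕ → ℝ) => consPath p.1 p.2) ⁻¹' (Set.pi (s : Set ℕ) t)
      = t' 0 ×ˢ Set.pi (Finset.range N : Set ℕ) (fun i => t' (i + 1)) := by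
    ext ⟨a, x⟩
    simp only [Set.mem_preimage, Set.mem_pi, Finset.mem_coe, Set.mem_prod]
    constructor
    · intro h
      refine ⟨?_, fun i _ => ?_⟩
      · simp only [ht']; split_ifs with h0
        exacts [h 0 h0, trivial]
      · simp only [ht']; split_ifs with h0
        exacts [h (i + 1) h0, trivial]
    · rintro ⟨h0, h⟩ i hi
      cases i with
      | zero => simpa [ht', hi, consPath] using h0
      | succ i =>
        have := h i (by have := hsN hi; simp only [Finset.mem_range] at this ⊢; omega)
        simpa [ht', hi, consPath] using this
  rw [hset, Measure.prod_prod, quenched, Measure.infinitePi_pi _ (fun i _ => ht'm _)]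
  have : ∏ i ∈ s, (e i : Measure ℝ) (t i) = ∏ i ∈ Finset.range (N + 1), (e i : Measure ℝ) (t' i) := by
    rw [← Finset.prod_subset hsN]
    · exact Finset.prod_congr rfl fun i hi => by simp [ht', hi]
    · intro i _ hi; simp [ht', hi]
  rw [this, Finset.prod_range_succ' _ N, mul_comm]
  rfl

lemma lintegral_quenched (e : Env) {f : (ℕ → ℝ) → ℝ≥0∞} (hf : Measurable f) :
    ∫⁻ x, f x ∂e.quenched =
      ∫⁻ a, ∫⁻ x, f (consPath a x) ∂e.shift.quenched ∂(e 0 : Measure ℝ) := by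
  rw [quenched_eq_map_consPath, lintegral_map hf measurable_consPath, lintegral_prod]
  exact (hf.comp measurable_consPath).aemeasurable

lemma measurable_apply_set (n : ℕ) {s : Set ℝ} (hs : MeasurableSet s) :
    Measurable fun e : Env => (e n : Measure ℝ) s :=
  (Measure.measurable_coe hs).comp (measurable_subtype_coe.comp (measurable_pi_apply n))

lemma measurable_quenched : Measurable quenched := by
  classical
  refine Measurable.measure_of_isPiSystem_of_isProbabilityMeasure
    (S := squareCylinders fun _ : ℕ => {s : Set ℝ | MeasurableSet s})
    (generateFrom_squareCylinders (α := fun _ : ℕ => ℝ)).symm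
    (isPiSystem_squareCylinders (fun _ => MeasurableSpace.isPiSystem_measurableSet)
      (fun _ => by simp)) ?_
  rintro _ ⟨s, t, ht, rfl⟩
  have ht' : ∀ i, MeasurableSet (t i) := fun i => ht i (Set.mem_univ i)
  simp only [quenched]
  simp_rw [Measure.infinitePi_pi _ (fun i _ => ht' i)]
  exact Finset.measurable_prod _ fun i _ => measurable_apply_set i (ht' i)

end Env

/-! ### Positive association -/

/-- Chebyshev's association inequality: two monotone functions of one random variable are
nonnegatively correlated. -/
lemma lintegral_mul_lintegral_le_of_monotone (μ : Measure ℝ) [IsProbabilityMeasure μ]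
    {f g : ℝ → ℝ≥0∞} (hf : Monotone f) (hg : Monotone g) :
    (∫⁻ a, f a ∂μ) * ∫⁻ a, g a ∂μ ≤ ∫⁻ a, f a * g a ∂μ := by
  have hfm := hf.measurable
  have hgm := hg.measurable
  have hpt : ∀ a b, f a * g b + f b * g a ≤ f a * g a + f b * g b := by
    intro a b
    wlog hab : a ≤ b generalizing a b
    · simpa [add_comm] using this b a (le_of_not_ge hab)
    -- The gap between the two sides is the product of the increments `u * v`; naming them avoids
    -- truncated subtraction.
    obtain ⟨u, hu⟩ := le_iff_exists_add.1 (hf hab)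
    obtain ⟨v, hv⟩ := le_iff_exists_add.1 (hg hab)
    rw [hu, hv]
    calc f a * (g a + v) + (f a + u) * g a
        ≤ f a * (g a + v) + (f a + u) * g a + u * v := le_self_add
      _ = f a * g a + (f a + u) * (g a + v) := by ring
  have hint := lintegral_mono (μ := μ) fun a => lintegral_mono (μ := μ) fun b => hpt a b
  have e1 : ∫⁻ a, ∫⁻ b, (f a * g b + f b * g a) ∂μ ∂μ
      = 2 * ((∫⁻ a, f a ∂μ) * ∫⁻ a, g a ∂μ) := by
    have : ∀ a, ∫⁻ b, (f a * g b + f b * g a) ∂μ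
        = f a * ∫⁻ b, g b ∂μ + (∫⁻ b, f b ∂μ) * g a := fun a => by
      rw [lintegral_add_left (hgm.const_mul _), lintegral_const_mul _ hgm,
        lintegral_mul_const _ hfm]
    simp_rw [this]
    rw [lintegral_add_left (hfm.mul_const _), lintegral_const_mul _ hgm,
        lintegral_mul_const _ hfm, two_mul]
  have e2 : ∫⁻ a, ∫⁻ b, (f a * g a + f b * g b) ∂μ ∂μ = 2 * ∫⁻ a, f a * g a ∂μ := by
    have : ∀ a, ∫⁻ b, (f a * g a + f b * g b) ∂μ = f a * g a + ∫⁻ b, f b * g b ∂μ := fun a => by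
      rw [lintegral_add_left measurable_const]; simp
    simp_rw [this]
    rw [lintegral_add_right _ measurable_const, two_mul]; simp
  rw [e1, e2] at hint
  exact (ENNReal.mul_le_mul_iff_right (by simp) (by simp)).1 hint

namespace Env

/-- The `ℝ≥0∞`-valued version of `harmonicApprox`. -/
noncomputable def killedMean (n : ℕ) (e : Env) (y : ℝ) : ℝ≥0∞ :=
  ∫⁻ x in {x | (n : WithTop ℕ) < exitTime y x}, ENNReal.ofReal (y + walk n x) ∂e.quenched

/-- The probability of survival up to time `n`. -/
noncomputable def survival (n : ℕ) (e : Env) (y : ℝ) : ℝ≥0∞ :=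
  e.quenched {x | (n : WithTop ℕ) < exitTime y x}

/-- `E_e[(y + S n)⁺]`. -/
noncomputable def posMean (n : ℕ) (e : Env) (y : ℝ) : ℝ≥0∞ :=
  ∫⁻ x, ENNReal.ofReal (y + walk n x) ∂e.quenched

lemma measurable_ofReal_add_walk (n : ℕ) (y : ℝ) :
    Measurable fun x => ENNReal.ofReal (y + walk n x) :=
  ((measurable_walk n).const_add y).ennreal_ofReal

lemma survival_mono (n : ℕ) (e : Env) : Monotone (survival n e) := fun _ _ h =>
  measure_mono fun _ hx => lt_exitTime_mono h hx

lemma posMean_mono (n : ℕ) (e : Env) : Monotone (posMean n e) := fun _ _ h =>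
  lintegral_mono fun _ => ENNReal.ofReal_le_ofReal (by linarith)

lemma killedMean_mono (n : ℕ) (e : Env) : Monotone (killedMean n e) := fun _ _ h =>
  lintegral_mono' (Measure.restrict_mono (fun _ hx => lt_exitTime_mono h hx) le_rfl)
    fun _ => ENNReal.ofReal_le_ofReal (by linarith)

lemma posMean_succ (n : ℕ) (e : Env) (y : ℝ) :
    posMean (n + 1) e y = ∫⁻ a, posMean n e.shift (y + a) ∂(e 0 : Measure ℝ) := by
  rw [posMean, lintegral_quenched e (measurable_ofReal_add_walk _ _)]
  simp only [walk_consPath, posMean, add_assoc]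

lemma survival_succ (n : ℕ) (e : Env) (y : ℝ) :
    survival (n + 1) e y = ∫⁻ a, Set.indicator {a | 0 < y + a}
      (fun a => survival n e.shift (y + a)) a ∂(e 0 : Measure ℝ) := by
  rw [survival, ← lintegral_indicator_one (measurableSet_lt_exitTime _ _),
    lintegral_quenched e (measurable_one.indicator (measurableSet_lt_exitTime _ _))]
  refine lintegral_congr fun a => ?_
  by_cases ha : 0 < y + a
  · rw [Set.indicator_of_mem (by exact ha), survival,
      ← lintegral_indicator_one (measurableSet_lt_exitTime _ _)]
    refine lintegral_congr fun x => ?_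
    simp only [Set.indicator, Set.mem_ofPred_eq, succ_lt_exitTime_consPath, ha, true_and,
      Pi.one_apply]
  · rw [Set.indicator_of_notMem (by exact ha)]
    simp [Set.indicator, succ_lt_exitTime_consPath, ha, -Nat.cast_add]

lemma killedMean_succ (n : ℕ) (e : Env) (y : ℝ) :
    killedMean (n + 1) e y = ∫⁻ a, Set.indicator {a | 0 < y + a}
      (fun a => killedMean n e.shift (y + a)) a ∂(e 0 : Measure ℝ) := by
  rw [killedMean, ← lintegral_indicator (measurableSet_lt_exitTime _ _),
    lintegral_quenched e ((measurable_ofReal_add_walk _ _).indicator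
      (measurableSet_lt_exitTime _ _))]
  refine lintegral_congr fun a => ?_
  by_cases ha : 0 < y + a
  · rw [Set.indicator_of_mem (by exact ha), killedMean,
      ← lintegral_indicator (measurableSet_lt_exitTime _ _)]
    refine lintegral_congr fun x => ?_
    simp only [Set.indicator, Set.mem_ofPred_eq, succ_lt_exitTime_consPath, ha, true_and,
      walk_consPath, add_assoc]
  · rw [Set.indicator_of_notMem (by exact ha)]
    simp [Set.indicator, succ_lt_exitTime_consPath, ha, -Nat.cast_add]

/-- Harris' inequality for the walk: survival and the size of the walk at the end are
positively correlated. -/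
lemma posMean_mul_survival_le (n : ℕ) (e : Env) (y : ℝ) :
    posMean n e y * survival n e y ≤ killedMean n e y := by
  induction n generalizing e y with
  | zero =>
    have : {x | ((0 : ℕ) : WithTop ℕ) < exitTime y x} = Set.univ :=
      Set.eq_univ_of_forall fun x => zero_lt_exitTime y x
    rw [posMean, survival, killedMean, this]; simp
  | succ n ih =>
    rw [posMean_succ, survival_succ, killedMean_succ]
    -- Chebyshev's inequality handles the first increment, both factors being monotone in it; the
    -- induction hypothesis handles the remaining walk from `y + a`.
    refine (lintegral_mul_lintegral_le_of_monotone _ ?_ ?_).trans (lintegral_mono fun a => ?_)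
    · exact fun a b h => posMean_mono _ _ (by linarith)
    · intro a b h
      by_cases ha : 0 < y + a
      · rw [Set.indicator_of_mem (by exact ha),
          Set.indicator_of_mem (by change 0 < y + b; linarith)]
        exact survival_mono _ _ (by linarith)
      · rw [Set.indicator_of_notMem (by exact ha)]; exact zero_le
    · by_cases ha : 0 < y + a
      · rw [Set.indicator_of_mem (by exact ha), Set.indicator_of_mem (by exact ha)]
        exact ih _ _
      · rw [Set.indicator_of_notMem (by exact ha)]; simp

end Env

namespace Env

/-! ### Independence of the increments -/

/-- Extending a finite block by zeros factors each function through its own coordinates, which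
reduces the claim to independence of disjoint blocks. -/
lemma indepFun_of_dependsOn (e : Env) {β γ : Type*} [MeasurableSpace β] [MeasurableSpace γ]
    {f : (ℕ → ℝ) → β} {g : (ℕ → ℝ) → γ} (hf : Measurable f) (hg : Measurable g)
    {S T : Finset ℕ} (hST : Disjoint S T) (hfS : DependsOn f (S : Set ℕ))
    (hgT : DependsOn g (T : Set ℕ)) : IndepFun f g e.quenched := by
  classical
  have hind : iIndepFun (fun (i : ℕ) (x : ℕ → ℝ) => x i) e.quenched :=
    iIndepFun_infinitePi (P := fun n => (e n : Measure ℝ)) (X := fun _ a => a)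
      fun _ => measurable_id
  have h := hind.indepFun_finset S T hST fun i => measurable_pi_apply i
  let ext : (S : Finset ℕ) → (S → ℝ) → ℕ → ℝ := fun S r i => if h : i ∈ S then r ⟨i, h⟩ else 0
  have hext : ∀ S, Measurable (ext S) := fun S => by
    refine measurable_pi_lambda _ fun i => ?_
    by_cases h : i ∈ S
    · simpa [ext, h] using measurable_pi_apply _
    · simp [ext, h]
  have h2 := h.comp (hf.comp (hext S)) (hg.comp (hext T))
  have ef : (f ∘ ext S) ∘ (fun (x : ℕ → ℝ) (i : S) => x i) = f := by
    funext x
    refine hfS fun i hi => ?_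
    have hi' : i ∈ S := hi
    simp [ext, hi']
  have eg : (g ∘ ext T) ∘ (fun (x : ℕ → ℝ) (i : T) => x i) = g := by
    funext x
    refine hgT fun i hi => ?_
    have hi' : i ∈ T := hi
    simp [ext, hi']
  rwa [ef, eg] at h2

lemma dependsOn_walk {k n : ℕ} (hk : k ≤ n) : DependsOn (walk k) (Finset.range n : Set ℕ) := by
  intro x y h
  refine Finset.sum_congr rfl fun i hi => h i ?_
  simp only [Finset.coe_range, Set.mem_Iio, Finset.mem_range] at *
  omega

lemma dependsOn_lt_exitTime (n : ℕ) (y : ℝ) :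
    DependsOn (fun x => (n : WithTop ℕ) < exitTime y x) (Finset.range n : Set ℕ) := by
  intro x x' h
  simp only [lt_exitTime_iff, eq_iff_iff]
  exact forall_congr' fun k => forall_congr' fun _ => forall_congr' fun hk => by
    rw [dependsOn_walk hk h]

lemma dependsOn_eval (n : ℕ) {β : Type*} (g : ℝ → β) :
    DependsOn (fun x : ℕ → ℝ => g (x n)) (({n} : Finset ℕ) : Set ℕ) := by
  intro x y h
  simp only [h n (by simp)]

lemma disjoint_range_singleton (n : ℕ) : Disjoint (Finset.range n) {n} := by simp

/-- The increments are integrable and centered. -/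
structure IsCentered (e : Env) : Prop where
  integrable : ∀ n, Integrable (fun a : ℝ => a) (e n : Measure ℝ)
  integral_eq_zero : ∀ n, ∫ a, a ∂(e n : Measure ℝ) = 0

lemma integral_eval (e : Env) (n : ℕ) {E : Type*} [NormedAddCommGroup E] [NormedSpace ℝ E]
    {g : ℝ → E} (hg : StronglyMeasurable g) :
    ∫ x, g (x n) ∂e.quenched = ∫ a, g a ∂(e n : Measure ℝ) := by
  rw [← (measurePreserving_eval e n).map_eq,
    integral_map (measurable_pi_apply n).aemeasurable hg.aestronglyMeasurable]

lemma integrable_eval (e : Env) (n : ℕ) {E : Type*} [NormedAddCommGroup E]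
    {g : ℝ → E} (hg : Integrable g (e n : Measure ℝ)) :
    Integrable (fun x : ℕ → ℝ => g (x n)) e.quenched :=
  (measurePreserving_eval e n).integrable_comp_of_integrable hg

lemma IsCentered.integrable_walk {e : Env} (he : e.IsCentered) (n : ℕ) :
    Integrable (walk n) e.quenched := by
  unfold walk
  exact integrable_finsetSum _ fun i _ => integrable_eval e i (he.integrable i)

lemma IsCentered.integral_walk {e : Env} (he : e.IsCentered) (n : ℕ) :
    ∫ x, walk n x ∂e.quenched = 0 := by
  unfold walk
  rw [integral_finsetSum _ fun i _ => integrable_eval e i (he.integrable i)]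
  refine Finset.sum_eq_zero fun i _ => ?_
  exact (integral_eval e i stronglyMeasurable_id).trans (he.integral_eq_zero i)

/-! ### A lower bound for the first absolute moment by a Riesz product -/

/-- The centered indicator of a positive increment. -/
noncomputable def centeredSign (e : Env) (k : ℕ) (a : ℝ) : ℝ :=
  (Set.Ioi (0 : ℝ)).indicator 1 a - (e k : Measure ℝ).real (Set.Ioi 0)

lemma measurable_centeredSign (e : Env) (k : ℕ) : Measurable (e.centeredSign k) :=
  (measurable_one.indicator measurableSet_Ioi).sub_const _

lemma abs_centeredSign_le (e : Env) (k : ℕ) (a : ℝ) : |e.centeredSign k a| ≤ 1 := by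
  have h0 : 0 ≤ (e k : Measure ℝ).real (Set.Ioi 0) := measureReal_nonneg
  have h1 : (e k : Measure ℝ).real (Set.Ioi 0) ≤ 1 := measureReal_le_one
  unfold centeredSign Set.indicator
  rw [abs_le]
  split_ifs <;> constructor <;> first | linarith | (rw [Pi.one_apply]; linarith)

lemma integrable_centeredSign (e : Env) (k : ℕ) :
    Integrable (e.centeredSign k) (e k : Measure ℝ) :=
  Integrable.of_bound (measurable_centeredSign e k).aestronglyMeasurable 1
    (ae_of_all _ fun a => by simpa using abs_centeredSign_le e k a)

lemma integral_centeredSign (e : Env) (k : ℕ) :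
    ∫ a, e.centeredSign k a ∂(e k : Measure ℝ) = 0 := by
  unfold centeredSign
  have hi : Integrable ((Set.Ioi (0 : ℝ)).indicator 1) (e k : Measure ℝ) :=
    (integrable_const (1 : ℝ)).indicator measurableSet_Ioi
  rw [integral_sub hi (integrable_const _), integral_indicator_one measurableSet_Ioi]
  simp

/-- The mean of the positive part of an increment. -/
noncomputable def posPartMean (e : Env) (k : ℕ) : ℝ := ∫ a, max a 0 ∂(e k : Measure ℝ)

/-- The product with the indicator is the positive part, and the centering constant contributes
nothing because the increment has mean zero. -/
lemma IsCentered.integral_mul_centeredSign {e : Env} (he : e.IsCentered) (k : ℕ) :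
    ∫ a, a * e.centeredSign k a ∂(e k : Measure ℝ) = e.posPartMean k := by
  have h : ∀ a : ℝ, a * e.centeredSign k a =
      max a 0 - a * (e k : Measure ℝ).real (Set.Ioi 0) := fun a => by
    unfold centeredSign Set.indicator
    split_ifs with h
    · rw [max_eq_left (le_of_lt h)]; simp; ring
    · rw [max_eq_right (not_lt.1 h)]; ring
  simp_rw [h]
  have hi : Integrable (fun a => max a 0) (e k : Measure ℝ) :=
    (he.integrable k).sup (integrable_const 0)
  rw [integral_sub hi ((he.integrable k).mul_const _),
    integral_mul_const, he.integral_eq_zero k]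
  simp [posPartMean]

/-- The factor `1 + i t φ` of the Riesz product. -/
noncomputable def rieszFactor (e : Env) (t : ℝ) (k : ℕ) (a : ℝ) : ℂ :=
  (1 : ℝ) + (t * e.centeredSign k a : ℝ) * Complex.I

lemma measurable_rieszFactor (e : Env) (t : ℝ) (k : ℕ) : Measurable (e.rieszFactor t k) := by
  have := measurable_centeredSign e k
  unfold rieszFactor; fun_prop

/-- The perturbation is purely imaginary, so it costs only second order in `t`: the modulus is at
most `√(1 + t²)`. This lets `t` be as large as `1/√n` over `n` factors. -/
lemma norm_rieszFactor_le (e : Env) (t : ℝ) (k : ℕ) (a : ℝ) :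
    ‖e.rieszFactor t k a‖ ≤ Real.exp (t ^ 2 / 2) := by
  rw [rieszFactor, Complex.norm_add_mul_I]
  refine Real.sqrt_le_iff.2 ⟨(Real.exp_pos _).le, ?_⟩
  rw [← Real.exp_nat_mul]
  have h1 : (e.centeredSign k a) ^ 2 ≤ 1 := (sq_le_one_iff_abs_le_one _).2 (abs_centeredSign_le e k a)
  have h2 : t ^ 2 * (e.centeredSign k a) ^ 2 ≤ t ^ 2 * 1 := by gcongr
  have h3 := Real.add_one_le_exp (t ^ 2)
  rw [show ((2 : ℕ) : ℝ) * (t ^ 2 / 2) = t ^ 2 by push_cast; ring]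
  nlinarith

lemma integral_rieszFactor (e : Env) (t : ℝ) (k : ℕ) :
    ∫ a, e.rieszFactor t k a ∂(e k : Measure ℝ) = 1 := by
  unfold rieszFactor
  rw [integral_add (integrable_const _)
    ((((integrable_centeredSign e k).const_mul t).ofReal).mul_const _),
    integral_mul_const, integral_complex_ofReal, integral_complex_ofReal, integral_const_mul,
    integral_centeredSign]
  simp

lemma IsCentered.integrable_mul_rieszFactor {e : Env} (he : e.IsCentered) (t : ℝ) (k : ℕ) :
    Integrable (fun a => e.rieszFactor t k a * (a : ℂ)) (e k : Measure ℝ) :=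
  (he.integrable k).ofReal.bdd_mul (measurable_rieszFactor e t k).aestronglyMeasurable
    (ae_of_all _ fun a => norm_rieszFactor_le e t k a)

lemma IsCentered.integral_mul_rieszFactor {e : Env} (he : e.IsCentered) (t : ℝ) (k : ℕ) :
    ∫ a, e.rieszFactor t k a * (a : ℂ) ∂(e k : Measure ℝ) = (t * e.posPartMean k : ℝ) * Complex.I := by
  have h : ∀ a : ℝ, e.rieszFactor t k a * (a : ℂ) =
      (a : ℂ) + (t * (a * e.centeredSign k a) : ℝ) * Complex.I := fun a => by
    unfold rieszFactor; push_cast; ring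
  have hi : Integrable (fun a => a * e.centeredSign k a) (e k : Measure ℝ) := by
    have := (he.integrable k).bdd_mul (c := 1) (measurable_centeredSign e k).aestronglyMeasurable
      (ae_of_all _ fun a => by simpa using abs_centeredSign_le e k a)
    simpa [mul_comm] using this
  simp_rw [h]
  rw [integral_add (he.integrable k).ofReal ((hi.const_mul t).ofReal.mul_const _),
    integral_mul_const, integral_complex_ofReal, integral_complex_ofReal, integral_const_mul,
    he.integral_mul_centeredSign, he.integral_eq_zero]
  simp

/-- The Riesz product `∏ (1 + i t φ)` over the first `n` increments. -/
noncomputable def rieszProd (e : Env) (t : ℝ) (n : ℕ) (x : ℕ → ℝ) : ℂ :=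
  ∏ k ∈ Finset.range n, e.rieszFactor t k (x k)

lemma rieszProd_succ (e : Env) (t : ℝ) (n : ℕ) (x : ℕ → ℝ) :
    e.rieszProd t (n + 1) x = e.rieszProd t n x * e.rieszFactor t n (x n) :=
  Finset.prod_range_succ _ _

lemma measurable_rieszProd (e : Env) (t : ℝ) (n : ℕ) : Measurable (e.rieszProd t n) :=
  Finset.measurable_prod _ fun k _ => (measurable_rieszFactor e t k).comp (measurable_pi_apply k)

lemma dependsOn_rieszProd (e : Env) (t : ℝ) (n : ℕ) :
    DependsOn (e.rieszProd t n) (Finset.range n : Set ℕ) := by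
  intro x y h
  exact Finset.prod_congr rfl fun k hk => by rw [h k hk]

lemma norm_rieszProd_le (e : Env) (t : ℝ) (n : ℕ) (x : ℕ → ℝ) :
    ‖e.rieszProd t n x‖ ≤ Real.exp (n * (t ^ 2 / 2)) := by
  rw [rieszProd, norm_prod, Real.exp_nat_mul]
  refine (Finset.prod_le_prod (fun _ _ => norm_nonneg _)
    fun k _ => norm_rieszFactor_le e t k (x k)).trans ?_
  simp

lemma integral_rieszProd (e : Env) (t : ℝ) (n : ℕ) :
    ∫ x, e.rieszProd t n x ∂e.quenched = 1 := by
  induction n with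
  | zero => simp [rieszProd]
  | succ n ih =>
    have hm := measurable_rieszFactor e t n
    have hind := e.indepFun_of_dependsOn (measurable_rieszProd e t n)
      (hm.comp (measurable_pi_apply n)) (disjoint_range_singleton n)
      (dependsOn_rieszProd e t n) (dependsOn_eval n (e.rieszFactor t n))
    simp_rw [rieszProd_succ]
    have e1 := hind.integral_fun_mul_eq_mul_integral
      (measurable_rieszProd e t n).aestronglyMeasurable
      (hm.comp (measurable_pi_apply n)).aestronglyMeasurable
    simp only [Function.comp_apply] at e1
    rw [e1, ih, integral_eval e n hm.stronglyMeasurable, integral_rieszFactor, one_mul]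

lemma IsCentered.integrable_walk_mul_rieszProd {e : Env} (he : e.IsCentered) (t : ℝ) (n : ℕ) :
    Integrable (fun x => e.rieszProd t n x * (walk n x : ℂ)) e.quenched :=
  (he.integrable_walk n).ofReal.bdd_mul (measurable_rieszProd e t n).aestronglyMeasurable
    (ae_of_all _ fun x => norm_rieszProd_le e t n x)

/-- The last step adds two terms: the old sum times a new factor of mean one, and the old product,
of mean one, times `E[(1 + i t φ) X] = i t E X⁺`. -/
lemma IsCentered.integral_walk_mul_rieszProd {e : Env} (he : e.IsCentered) (t : ℝ) (n : ℕ) :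
    ∫ x, e.rieszProd t n x * (walk n x : ℂ) ∂e.quenched =
      (t * ∑ k ∈ Finset.range n, e.posPartMean k : ℝ) * Complex.I := by
  induction n with
  | zero => simp [walk_zero]
  | succ n ih =>
    have hm := measurable_rieszFactor e t n
    have hR := measurable_rieszProd e t n
    have hW : Measurable fun x => e.rieszProd t n x * (walk n x : ℂ) :=
      hR.mul (Complex.measurable_ofReal.comp (measurable_walk n))
    have hWd : DependsOn (fun x => e.rieszProd t n x * (walk n x : ℂ))
        (Finset.range n : Set ℕ) := fun x y h => by
      simp only [dependsOn_rieszProd e t n h, dependsOn_walk le_rfl h]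
    have hm2 : Measurable fun a : ℝ => e.rieszFactor t n a * (a : ℂ) :=
      hm.mul Complex.measurable_ofReal
    have hind1 := e.indepFun_of_dependsOn hW (hm.comp (measurable_pi_apply n))
      (disjoint_range_singleton n) hWd (dependsOn_eval n (e.rieszFactor t n))
    have hind2 := e.indepFun_of_dependsOn hR (hm2.comp (measurable_pi_apply n))
      (disjoint_range_singleton n) (dependsOn_rieszProd e t n)
      (dependsOn_eval n fun a : ℝ => e.rieszFactor t n a * (a : ℂ))
    have hi1 := hind1.integrable_mul (he.integrable_walk_mul_rieszProd t n)
      (integrable_eval e n (Integrable.of_bound hm.aestronglyMeasurable _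
        (ae_of_all _ fun a => norm_rieszFactor_le e t n a)))
    have hi2 := hind2.integrable_mul
      (Integrable.of_bound hR.aestronglyMeasurable _ (ae_of_all _ fun a => norm_rieszProd_le e t n a))
      (integrable_eval e n (he.integrable_mul_rieszFactor t n))
    have hsplit : ∀ x : ℕ → ℝ, e.rieszProd t (n + 1) x * (walk (n + 1) x : ℂ) =
        (e.rieszProd t n x * (walk n x : ℂ)) * e.rieszFactor t n (x n) +
        e.rieszProd t n x * (e.rieszFactor t n (x n) * (x n : ℂ)) := fun x => by
      rw [rieszProd_succ, walk_succ]; push_cast; ring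
    simp_rw [hsplit]
    refine (integral_add hi1 hi2).trans ?_
    simp only [Pi.mul_apply, Function.comp_apply]
    have e1 := hind1.integral_fun_mul_eq_mul_integral hW.aestronglyMeasurable
      (hm.comp (measurable_pi_apply n)).aestronglyMeasurable
    have e2 := hind2.integral_fun_mul_eq_mul_integral hR.aestronglyMeasurable
      (hm2.comp (measurable_pi_apply n)).aestronglyMeasurable
    simp only [Function.comp_apply] at e1 e2
    rw [e1, e2, ih, integral_rieszProd, integral_eval e n hm.stronglyMeasurable,
      integral_eval e n hm2.stronglyMeasurable, integral_rieszFactor,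
      he.integral_mul_rieszFactor, Finset.sum_range_succ]
    push_cast; ring

lemma IsCentered.sum_posPartMean_le_integral_abs_walk {e : Env} (he : e.IsCentered) (t : ℝ)
    (n : ℕ) : t * ∑ k ∈ Finset.range n, e.posPartMean k ≤
      Real.exp (n * (t ^ 2 / 2)) * ∫ x, |walk n x| ∂e.quenched := by
  have h := norm_integral_le_integral_norm (μ := e.quenched)
    (fun x => e.rieszProd t n x * (walk n x : ℂ))
  rw [he.integral_walk_mul_rieszProd t n, norm_mul, Complex.norm_I, mul_one, Complex.norm_real] at h
  refine (le_abs_self _).trans (h.trans ?_)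
  rw [← integral_const_mul]
  refine integral_mono (he.integrable_walk_mul_rieszProd t n).norm
    ((he.integrable_walk n).abs.const_mul _) fun x => ?_
  simp only [norm_mul, Complex.norm_real, Real.norm_eq_abs]
  gcongr
  exact norm_rieszProd_le e t n x

lemma IsCentered.posMean_ge {e : Env} (he : e.IsCentered) {n : ℕ} (hn : 0 < n) {y : ℝ}
    (hy : 0 ≤ y) :
    ENNReal.ofReal ((∑ k ∈ Finset.range n, e.posPartMean k) / (4 * √n)) ≤ posMean n e y := by
  refine le_trans ?_ (posMean_mono n e hy)
  have hn' : (0 : ℝ) < n := by exact_mod_cast hn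
  have hs : 0 < √(n : ℝ) := Real.sqrt_pos.2 hn'
  have hmax : Integrable (fun x => max (walk n x) 0) e.quenched :=
    (he.integrable_walk n).sup (integrable_const 0)
  have h1 : posMean n e 0 = ENNReal.ofReal (∫ x, max (walk n x) 0 ∂e.quenched) := by
    rw [posMean, ofReal_integral_eq_lintegral_ofReal hmax (ae_of_all _ fun x => le_max_right _ _)]
    refine lintegral_congr fun x => ?_
    rw [zero_add, ENNReal.ofReal_max]; simp
  have h2 : ∫ x, max (walk n x) 0 ∂e.quenched = (∫ x, |walk n x| ∂e.quenched) / 2 := by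
    have : ∀ x, max (walk n x) 0 = (walk n x + |walk n x|) * (1 / 2) := fun x => by
      rcases le_total 0 (walk n x) with h | h
      · rw [max_eq_left h, abs_of_nonneg h]; ring
      · rw [max_eq_right h, abs_of_nonpos h]; ring
    simp_rw [this]
    rw [integral_mul_const, integral_add (he.integrable_walk n) (he.integrable_walk n).abs,
      he.integral_walk n]
    ring
  rw [h1, h2]
  refine ENNReal.ofReal_le_ofReal ?_
  -- The choice `t = 1/√n` minimizes `exp (n t² / 2) / t`. The constant `4` collects `exp (1/2) ≤ 2`
  -- and the factor `2` between `E|S_n|` and `E S_n⁺`.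
  have h3 := he.sum_posPartMean_le_integral_abs_walk (1 / √n) n
  have h4 : (n : ℝ) * ((1 / √n) ^ 2 / 2) = 1 / 2 := by
    rw [div_pow, Real.sq_sqrt hn'.le]; field_simp
  rw [h4] at h3
  have h5 : Real.exp (1 / 2) ≤ 2 := by
    have := Real.exp_one_lt_d9
    have h6 : Real.exp (1 / 2) ^ 2 = Real.exp 1 := by rw [← Real.exp_nat_mul]; norm_num
    nlinarith [Real.exp_pos (1 / 2)]
  have h7 : 0 ≤ ∫ x, |walk n x| ∂e.quenched := integral_nonneg fun _ => abs_nonneg _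
  have h8 : Real.exp (1 / 2) * ∫ x, |walk n x| ∂e.quenched ≤ 2 * ∫ x, |walk n x| ∂e.quenched := by
    gcongr
  have h9 : (∑ k ∈ Finset.range n, e.posPartMean k) / (4 * √n) =
      (1 / √n * ∑ k ∈ Finset.range n, e.posPartMean k) / 4 := by field_simp
  rw [h9]; linarith

lemma IsCentered.mul_measureReal_Ioi_le_posPartMean {e : Env} (he : e.IsCentered) (k : ℕ)
    (δ : ℝ) : δ * (e k : Measure ℝ).real (Set.Ioi δ) ≤ e.posPartMean k := by
  have h : ∫ a, (Set.Ioi δ).indicator (fun _ => δ) a ∂(e k : Measure ℝ) =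
      δ * (e k : Measure ℝ).real (Set.Ioi δ) := by
    rw [integral_indicator_const _ measurableSet_Ioi, smul_eq_mul, mul_comm]
  rw [← h]
  refine integral_mono ((integrable_const δ).indicator measurableSet_Ioi)
    ((he.integrable k).sup (integrable_const 0)) fun a => ?_
  unfold Set.indicator
  split_ifs with h
  · exact (le_of_lt h).trans (le_max_left _ _)
  · exact le_max_right _ _

end Env

/-! ### The walk stopped at its exit time -/

/-- The walk from `y` on the event of survival up to time `n`, and `0` off this event. -/
noncomputable def killedWalk (n : ℕ) (y : ℝ) : (ℕ → ℝ) → ℝ :=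
  Set.indicator {x | (n : WithTop ℕ) < exitTime y x} fun x => y + walk n x

open Classical in
/-- The distance below `0` of the walk at its exit time, if this happened up to time `n`. -/
noncomputable def overshoot (n : ℕ) (y : ℝ) (x : ℕ → ℝ) : ℝ :=
  if (n : WithTop ℕ) < exitTime y x then 0 else -(y + stoppedValue walk (exitTime y) x)

lemma stoppedValue_walk_of_exit {k : ℕ} {y : ℝ} {x : ℕ → ℝ}
    (h1 : (k : WithTop ℕ) < exitTime y x) (h2 : ¬ ((k + 1 : ℕ) : WithTop ℕ) < exitTime y x) :
    stoppedValue walk (exitTime y) x = walk (k + 1) x := by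
  have : exitTime y x = ((k + 1 : ℕ) : WithTop ℕ) := by
    refine le_antisymm (not_lt.1 h2) ?_
    cases h : exitTime y x with
    | top => exact le_top
    | coe m =>
      rw [h] at h1
      have : k < m := WithTop.coe_lt_coe.1 h1
      exact WithTop.coe_le_coe.2 this
  rw [stoppedValue, this]
  rfl

lemma killedWalk_of_lt {n : ℕ} {y : ℝ} {x : ℕ → ℝ} (h : (n : WithTop ℕ) < exitTime y x) :
    killedWalk n y x = y + walk n x := Set.indicator_of_mem (by exact h) _

lemma killedWalk_of_not_lt {n : ℕ} {y : ℝ} {x : ℕ → ℝ} (h : ¬ (n : WithTop ℕ) < exitTime y x) :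
    killedWalk n y x = 0 := Set.indicator_of_notMem (by exact h) _

lemma overshoot_of_lt {n : ℕ} {y : ℝ} {x : ℕ → ℝ} (h : (n : WithTop ℕ) < exitTime y x) :
    overshoot n y x = 0 := if_pos h

lemma overshoot_of_not_lt {n : ℕ} {y : ℝ} {x : ℕ → ℝ} (h : ¬ (n : WithTop ℕ) < exitTime y x) :
    overshoot n y x = -(y + stoppedValue walk (exitTime y) x) := if_neg h

lemma overshoot_succ_of_exit {n : ℕ} {y : ℝ} {x : ℕ → ℝ}
    (h1 : (n : WithTop ℕ) < exitTime y x) (h2 : ¬ ((n + 1 : ℕ) : WithTop ℕ) < exitTime y x) :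
    overshoot (n + 1) y x = -(y + walk (n + 1) x) := by
  rw [overshoot_of_not_lt h2, stoppedValue_walk_of_exit h1 h2]

/-- Both sides are `y` plus the walk stopped at `n ∧ τ_y`: the left side separates survival from
exit, the right side sums the increments taken before the exit. -/
lemma killedWalk_sub_overshoot (n : ℕ) (y : ℝ) (x : ℕ → ℝ) :
    killedWalk n y x - overshoot n y x = y + ∑ k ∈ Finset.range n,
      Set.indicator {x | (k : WithTop ℕ) < exitTime y x} (fun x => x k) x := by
  induction n with
  | zero =>
    rw [killedWalk_of_lt (zero_lt_exitTime y x), overshoot_of_lt (zero_lt_exitTime y x)]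
    simp [walk_zero]
  | succ n ih =>
    rw [Finset.sum_range_succ, ← add_assoc, ← ih]
    by_cases h1 : (n : WithTop ℕ) < exitTime y x
    · rw [Set.indicator_of_mem (by exact h1), killedWalk_of_lt h1, overshoot_of_lt h1]
      by_cases h2 : ((n + 1 : ℕ) : WithTop ℕ) < exitTime y x
      · rw [killedWalk_of_lt h2, overshoot_of_lt h2, walk_succ]; ring
      · rw [killedWalk_of_not_lt h2, overshoot_succ_of_exit h1 h2, walk_succ]; ring
    · have h2 : ¬ ((n + 1 : ℕ) : WithTop ℕ) < exitTime y x := fun h =>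
        h1 (lt_exitTime_anti (Nat.le_succ n) h)
      rw [Set.indicator_of_notMem (by exact h1), killedWalk_of_not_lt h1,
        overshoot_of_not_lt h1, killedWalk_of_not_lt h2, overshoot_of_not_lt h2]
      ring

/-- The value changes only at the exit step, where it jumps from `0` to a nonnegative number. -/
lemma overshoot_le_succ (n : ℕ) (y : ℝ) (x : ℕ → ℝ) :
    overshoot n y x ≤ overshoot (n + 1) y x := by
  by_cases h2 : ((n + 1 : ℕ) : WithTop ℕ) < exitTime y x
  · rw [overshoot_of_lt h2, overshoot_of_lt (lt_exitTime_anti (Nat.le_succ n) h2)]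
  by_cases h1 : (n : WithTop ℕ) < exitTime y x
  · rw [overshoot_of_lt h1, overshoot_succ_of_exit h1 h2]
    have := fun h => h2 (succ_lt_exitTime_iff.2 ⟨h1, h⟩)
    linarith [not_lt.1 this]
  · rw [overshoot_of_not_lt h1, overshoot_of_not_lt h2]

lemma overshoot_mono (y : ℝ) (x : ℕ → ℝ) : Monotone fun n => overshoot n y x :=
  monotone_nat_of_le_succ fun n => overshoot_le_succ n y x

lemma overshoot_zero (y : ℝ) (x : ℕ → ℝ) : overshoot 0 y x = 0 :=
  overshoot_of_lt (zero_lt_exitTime y x)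

lemma overshoot_nonneg (n : ℕ) (y : ℝ) (x : ℕ → ℝ) : 0 ≤ overshoot n y x := by
  rw [← overshoot_zero y x]; exact overshoot_mono y x (Nat.zero_le n)

/-- The overshoot is at most the last jump. -/
lemma overshoot_le_add_indicator {n m : ℕ} (hnm : n ≤ m) {y : ℝ} (hy : 0 ≤ y) {x : ℕ → ℝ} {B : ℝ}
    (hB0 : 0 ≤ B) (hB : ∀ k ∈ Finset.Ico n m, |x k| ≤ B) :
    overshoot m y x ≤ overshoot n y x +
      Set.indicator {x | (n : WithTop ℕ) < exitTime y x} (fun _ => B) x := by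
  by_cases hn : (n : WithTop ℕ) < exitTime y x
  · rw [Set.indicator_of_mem (by exact hn), overshoot_of_lt hn, zero_add]
    induction m, hnm using Nat.le_induction with
    | base => rwa [overshoot_of_lt hn]
    | succ m hm ih =>
      have ih' := ih fun k hk => hB k (by simp only [Finset.mem_Ico] at *; omega)
      by_cases h1 : (m : WithTop ℕ) < exitTime y x
      · by_cases h2 : ((m + 1 : ℕ) : WithTop ℕ) < exitTime y x
        · rwa [overshoot_of_lt h2]
        · rw [overshoot_succ_of_exit h1 h2, walk_succ]
          have h3 := hB m (by simp only [Finset.mem_Ico]; omega)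
          -- Just before the exit the walk is nonnegative, with `hy` covering `m = 0`.
          have h4 := nonneg_of_lt_exitTime hy h1
          linarith [neg_abs_le (x m)]
      · have h2 : ¬ ((m + 1 : ℕ) : WithTop ℕ) < exitTime y x := fun h =>
          h1 (lt_exitTime_anti (Nat.le_succ m) h)
        rwa [overshoot_of_not_lt h2, ← overshoot_of_not_lt h1]
  · have hm : ¬ (m : WithTop ℕ) < exitTime y x := fun h => hn (lt_exitTime_anti hnm h)
    rw [Set.indicator_of_notMem (by exact hn), overshoot_of_not_lt hn, overshoot_of_not_lt hm,
      add_zero]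

/-- Truncation at level `L`, left free so that it can be balanced against the moments when a maximum
of jumps is bounded by a sum. -/
lemma abs_le_add_rpow_mul {L p : ℝ} (hL : 0 < L) (hp : 1 ≤ p) (a : ℝ) :
    |a| ≤ L + L ^ (1 - p) * |a| ^ p := by
  have h0 : 0 ≤ L ^ (1 - p) * |a| ^ p := by positivity
  rcases le_or_gt |a| L with h | h
  · linarith
  · have ha : 0 < |a| := hL.trans h
    have h1 : |a| ^ (1 - p) ≤ L ^ (1 - p) :=
      Real.rpow_le_rpow_of_nonpos hL h.le (by linarith)
    calc |a| = |a| ^ (1 - p) * |a| ^ p := by rw [← Real.rpow_add ha]; simp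
      _ ≤ L ^ (1 - p) * |a| ^ p := by gcongr
      _ ≤ _ := by linarith

namespace Env

lemma integrable_killedWalk {e : Env} (he : e.IsCentered) (n : ℕ) (y : ℝ) :
    Integrable (killedWalk n y) e.quenched :=
  ((integrable_const y).add (he.integrable_walk n)).indicator (measurableSet_lt_exitTime n y)

lemma integrable_indicator_eval {e : Env} (he : e.IsCentered) (k : ℕ) (y : ℝ) :
    Integrable (Set.indicator {x | (k : WithTop ℕ) < exitTime y x} (fun x => x k)) e.quenched :=
  (integrable_eval e k (he.integrable k)).indicator (measurableSet_lt_exitTime k y)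

lemma integrable_overshoot {e : Env} (he : e.IsCentered) (n : ℕ) (y : ℝ) :
    Integrable (overshoot n y) e.quenched := by
  have h : overshoot n y = fun x => killedWalk n y x - (y + ∑ k ∈ Finset.range n,
      Set.indicator {x | (k : WithTop ℕ) < exitTime y x} (fun x => x k) x) := by
    funext x; rw [← killedWalk_sub_overshoot]; ring
  rw [h]
  exact (integrable_killedWalk he n y).sub ((integrable_const y).add
    (integrable_finsetSum _ fun k _ => integrable_indicator_eval he k y))

lemma dependsOn_indicator_lt_exitTime (n : ℕ) (y : ℝ) {β : Type*} [Zero β] (c : β) :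
    DependsOn (Set.indicator {x | (n : WithTop ℕ) < exitTime y x} fun _ => c)
      (Finset.range n : Set ℕ) := by
  intro x x' h
  have := dependsOn_lt_exitTime n y h
  simp only [Set.indicator, Set.mem_ofPred_eq, this]

/-- Survival up to time `k` involves only the increments with index below `k`, so it is independent
of the centered increment with index `k`. -/
lemma integral_indicator_eval {e : Env} (he : e.IsCentered) (k : ℕ) (y : ℝ) :
    ∫ x, Set.indicator {x | (k : WithTop ℕ) < exitTime y x} (fun x => x k) x ∂e.quenched = 0 := by
  have hm : Measurable (Set.indicator {x | (k : WithTop ℕ) < exitTime y x} fun _ => (1 : ℝ)) :=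
    measurable_const.indicator (measurableSet_lt_exitTime k y)
  have hind := e.indepFun_of_dependsOn hm (measurable_pi_apply k) (disjoint_range_singleton k)
    (dependsOn_indicator_lt_exitTime k y (1 : ℝ)) (dependsOn_eval k fun a => a)
  have h : ∀ x : ℕ → ℝ, Set.indicator {x | (k : WithTop ℕ) < exitTime y x} (fun x => x k) x =
      Set.indicator {x | (k : WithTop ℕ) < exitTime y x} (fun _ => (1 : ℝ)) x * x k := fun x => by
    unfold Set.indicator; split_ifs <;> simp
  simp_rw [h]
  have h0 : ∫ x : ℕ → ℝ, x k ∂e.quenched = 0 :=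
    (integral_eval e k stronglyMeasurable_id).trans (he.integral_eq_zero k)
  rw [hind.integral_fun_mul_eq_mul_integral hm.aestronglyMeasurable
    (measurable_pi_apply k).aestronglyMeasurable, h0, mul_zero]

lemma harmonicApprox_eq_integral_killedWalk (n : ℕ) (e : Env) (y : ℝ) :
    e.harmonicApprox n y = ∫ x, killedWalk n y x ∂e.quenched :=
  (integral_indicator (measurableSet_lt_exitTime n y)).symm

/-- Optional stopping. -/
lemma harmonicApprox_eq_add_integral_overshoot {e : Env} (he : e.IsCentered) (n : ℕ) (y : ℝ) :
    e.harmonicApprox n y = y + ∫ x, overshoot n y x ∂e.quenched := by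
  have h : ∫ x, (killedWalk n y x - overshoot n y x) ∂e.quenched = y := by
    simp_rw [killedWalk_sub_overshoot]
    rw [integral_add (integrable_const y)
      (integrable_finsetSum _ fun k _ => integrable_indicator_eval he k y),
      integral_finsetSum _ fun k _ => integrable_indicator_eval he k y]
    simp [integral_indicator_eval he]
  rw [integral_sub (integrable_killedWalk he n y) (integrable_overshoot he n y)] at h
  rw [harmonicApprox_eq_integral_killedWalk]
  linarith

lemma monotone_harmonicApprox {e : Env} (he : e.IsCentered) (y : ℝ) :
    Monotone fun n => e.harmonicApprox n y := by
  intro n m h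
  simp only [harmonicApprox_eq_add_integral_overshoot he]
  gcongr
  exacts [integrable_overshoot he n y, integrable_overshoot he m y, fun x => overshoot_mono y x h]

lemma le_harmonicApprox {e : Env} (he : e.IsCentered) (n : ℕ) (y : ℝ) :
    y ≤ e.harmonicApprox n y := by
  rw [harmonicApprox_eq_add_integral_overshoot he]
  have : 0 ≤ ∫ x, overshoot n y x ∂e.quenched := integral_nonneg fun x => overshoot_nonneg n y x
  linarith

lemma killedMean_eq_ofReal {e : Env} (he : e.IsCentered) (n : ℕ) {y : ℝ} (hy : 0 ≤ y) :
    killedMean n e y = ENNReal.ofReal (e.harmonicApprox n y) := by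
  rw [killedMean, harmonicApprox, ofReal_integral_eq_lintegral_ofReal]
  · exact ((integrable_const y).add (he.integrable_walk n)).integrableOn
  · exact (ae_restrict_iff' (measurableSet_lt_exitTime n y)).2
      (ae_of_all _ fun x hx => nonneg_of_lt_exitTime hy hx)

/-- Survival is unlikely, compared to the mean of the killed walk. -/
lemma survival_mul_le {e : Env} (he : e.IsCentered) {n : ℕ} (hn : 0 < n) {y : ℝ} (hy : 0 ≤ y) :
    (∑ k ∈ Finset.range n, e.posPartMean k) / (4 * √n) * (survival n e y).toReal ≤
      e.harmonicApprox n y := by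
  have h := (mul_le_mul_left (he.posMean_ge hn hy) (survival n e y)).trans
    (posMean_mul_survival_le n e y)
  rw [killedMean_eq_ofReal he n hy] at h
  have hfin : survival n e y ≠ ∞ := measure_ne_top _ _
  have hnn : 0 ≤ (∑ k ∈ Finset.range n, e.posPartMean k) / (4 * √n) :=
    div_nonneg (Finset.sum_nonneg fun k _ => integral_nonneg fun a => le_max_right _ _)
      (by positivity)
  rw [← ENNReal.ofReal_toReal hfin, ← ENNReal.ofReal_mul hnn,
    ENNReal.ofReal_le_ofReal_iff (hy.trans (le_harmonicApprox he n y))] at h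
  exact h

/-- The overshoot gained after time `n` requires survival up to `n` and is at most the largest jump
in the block, which is bounded by `B`. As `B` depends only on increments with index at least `n`,
the expectation factorizes, and the second factor does not involve `y`. -/
lemma harmonicApprox_le_add {e : Env} (he : e.IsCentered) {n m : ℕ} (hnm : n ≤ m) {y : ℝ}
    (hy : 0 ≤ y) {L p : ℝ} (hL : 0 < L) (hp : 1 ≤ p)
    (hint : ∀ k, Integrable (fun a : ℝ => |a| ^ p) (e k : Measure ℝ)) :
    e.harmonicApprox m y ≤ e.harmonicApprox n y + (survival n e y).toReal *
      (L + L ^ (1 - p) * ∑ k ∈ Finset.Ico n m, ∫ a, |a| ^ p ∂(e k : Measure ℝ)) := by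
  set B : (ℕ → ℝ) → ℝ := fun x => L + L ^ (1 - p) * ∑ k ∈ Finset.Ico n m, |x k| ^ p with hB
  have hpm : Measurable fun a : ℝ => |a| ^ p := by fun_prop
  have hBm : Measurable B := by
    refine measurable_const.add (measurable_const.mul (Finset.measurable_sum _ fun k _ => ?_))
    exact hpm.comp (measurable_pi_apply k)
  have hsi : Integrable (fun x : ℕ → ℝ => ∑ k ∈ Finset.Ico n m, |x k| ^ p) e.quenched :=
    integrable_finsetSum _ fun k _ => integrable_eval e k (hint k)
  have hBi : Integrable B e.quenched := (integrable_const L).add (hsi.const_mul _)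
  have hBint : ∫ x, B x ∂e.quenched =
      L + L ^ (1 - p) * ∑ k ∈ Finset.Ico n m, ∫ a, |a| ^ p ∂(e k : Measure ℝ) := by
    rw [hB, integral_add (integrable_const L) (hsi.const_mul _), integral_const_mul,
      integral_finsetSum _ fun k _ => integrable_eval e k (hint k)]
    simp only [integral_eval e _ hpm.stronglyMeasurable]
    simp
  have hBd : DependsOn B (Finset.Ico n m : Set ℕ) := by
    intro x x' h
    simp only [hB]
    rw [Finset.sum_congr rfl fun k hk => by rw [h k hk]]
  have hm : Measurable (Set.indicator {x | (n : WithTop ℕ) < exitTime y x} fun _ => (1 : ℝ)) :=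
    measurable_const.indicator (measurableSet_lt_exitTime n y)
  have hdisj : Disjoint (Finset.range n) (Finset.Ico n m) := by
    rw [Finset.disjoint_left]; intro k; simp only [Finset.mem_range, Finset.mem_Ico]; omega
  have hind := e.indepFun_of_dependsOn hm hBm hdisj
    (dependsOn_indicator_lt_exitTime n y (1 : ℝ)) hBd
  have hprod := hind.integral_fun_mul_eq_mul_integral hm.aestronglyMeasurable
    hBm.aestronglyMeasurable
  rw [integral_indicator_const _ (measurableSet_lt_exitTime n y), hBint, smul_eq_mul,
    mul_one] at hprod
  have hinteg : Integrable (fun x => Set.indicator {x | (n : WithTop ℕ) < exitTime y x}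
      (fun _ => (1 : ℝ)) x * B x) e.quenched :=
    hBi.bdd_mul (c := 1) hm.aestronglyMeasurable (ae_of_all _ fun x => by
      unfold Set.indicator; split_ifs <;> simp)
  have hle : ∫ x, overshoot m y x ∂e.quenched ≤ ∫ x, (overshoot n y x +
      Set.indicator {x | (n : WithTop ℕ) < exitTime y x} (fun _ => (1 : ℝ)) x * B x)
        ∂e.quenched := by
    refine integral_mono (integrable_overshoot he m y)
      ((integrable_overshoot he n y).add hinteg) fun x => ?_
    have hsum0 : ∀ k ∈ Finset.Ico n m, 0 ≤ |x k| ^ p := fun k _ => by positivity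
    have hx := overshoot_le_add_indicator (x := x) (B := B x) hnm hy
      (by have := Finset.sum_nonneg hsum0; simp only [hB]; positivity)
      (fun k hk => (abs_le_add_rpow_mul hL hp (x k)).trans (by
        simp only [hB]
        have := Finset.single_le_sum hsum0 hk
        gcongr))
    refine hx.trans (le_of_eq ?_)
    congr 1
    unfold Set.indicator; split_ifs <;> simp
  rw [integral_add (integrable_overshoot he n y) hinteg, hprod] at hle
  rw [harmonicApprox_eq_add_integral_overshoot he, harmonicApprox_eq_add_integral_overshoot he,
    add_assoc]
  exact (add_le_add_iff_left y).2 hle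

end Env

namespace Env

/-! ### Environments with regular growth -/

/-- The properties of almost every environment on which the analysis of the walk rests. -/
structure IsGood (e : Env) : Prop extends IsCentered e where
  -- The condition `1 + η < p / 2` makes the largest of `n` jumps of order `n ^ ((1 + η) / p)`,
  -- which is below `√n`.
  moment : ∃ p η C : ℝ, 1 ≤ p ∧ 1 + η < p / 2 ∧ 0 ≤ 1 + η ∧ 0 ≤ C ∧
    (∀ k, Integrable (fun a : ℝ => |a| ^ p) (e k : Measure ℝ)) ∧
    ∀ n : ℕ, ∑ k ∈ Finset.range n, ∫ a, |a| ^ p ∂(e k : Measure ℝ) ≤ C * (n : ℝ) ^ (1 + η)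
  spread : ∃ δ c K : ℝ, 0 < δ ∧ 0 < c ∧
    ∀ n : ℕ, c * n - K ≤ ∑ k ∈ Finset.range n, (e k : Measure ℝ).real (Set.Ioi δ)
  pos : ∀ k, 0 < (e k : Measure ℝ) (Set.Ioi 0)

namespace IsGood

variable {e : Env}

lemma sqrt_mul_survival_le (he : e.IsGood) : ∃ κ : ℝ, 0 < κ ∧ ∃ N : ℕ, 0 < N ∧ ∀ n ≥ N, ∀ y : ℝ,
    0 ≤ y → κ * √n * (survival n e y).toReal ≤ e.harmonicApprox n y := by
  obtain ⟨δ, c, K, hδ, hc, h⟩ := he.spread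
  obtain ⟨N, hN⟩ := exists_nat_ge (2 * K / c)
  -- Once `c n ≥ 2 K`, the sum in `spread` is at least `c n / 2`; then `δ (c n / 2) / (4 √n) = (δ c
  -- / 8) √n`.
  refine ⟨δ * c / 8, by positivity, N + 1, by omega, fun n hn y hy => ?_⟩
  have hn0 : 0 < n := by omega
  have hn0' : (0 : ℝ) < n := by exact_mod_cast hn0
  refine le_trans ?_ (survival_mul_le he.toIsCentered hn0 hy)
  refine mul_le_mul_of_nonneg_right ?_ ENNReal.toReal_nonneg
  have h1 : (N : ℝ) + 1 ≤ n := by exact_mod_cast hn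
  have h2 : 2 * K ≤ c * n := by
    have : 2 * K ≤ N * c := (div_le_iff₀ hc).1 hN
    nlinarith
  have h3 : δ * (c * n / 2) ≤ ∑ k ∈ Finset.range n, e.posPartMean k := by
    calc δ * (c * n / 2) ≤ δ * ∑ k ∈ Finset.range n, (e k : Measure ℝ).real (Set.Ioi δ) := by
          gcongr; linarith [h n]
      _ = ∑ k ∈ Finset.range n, δ * (e k : Measure ℝ).real (Set.Ioi δ) := Finset.mul_sum _ _ _
      _ ≤ _ := Finset.sum_le_sum fun k _ =>
          he.toIsCentered.mul_measureReal_Ioi_le_posPartMean k δ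
  rw [le_div_iff₀ (by positivity)]
  refine le_trans (le_of_eq ?_) h3
  have h4 : √(n : ℝ) * √n = n := Real.mul_self_sqrt hn0'.le
  linear_combination (δ * c / 2) * h4

lemma harmonicApprox_two_mul_le (he : e.IsGood) : ∃ A s : ℝ, 0 ≤ A ∧ 0 < s ∧ ∃ N : ℕ, 0 < N ∧
    ∀ n ≥ N, ∀ y : ℝ, 0 ≤ y →
      e.harmonicApprox (2 * n) y ≤ (1 + A * (n : ℝ) ^ (-s)) * e.harmonicApprox n y := by
  obtain ⟨κ, hκ, N, hN, hsurv⟩ := he.sqrt_mul_survival_le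
  obtain ⟨p, η, C, hp, hη, hη0, hC, hint, hmom⟩ := he.moment
  have hp0 : 0 < p := by linarith
  -- Truncating at `L = n ^ q` balances `L` against `L ^ (1 - p) n ^ (1 + η)`. Dividing by the `√n`
  -- from the survival bound leaves `n ^ (-s)` with `s = 1/2 - q > 0`.
  set q := (1 + η) / p with hq
  set A₀ := 1 + C * 2 ^ (1 + η) with hA₀
  have hA₀0 : 0 ≤ A₀ := by positivity
  have hqp : q * p = 1 + η := by rw [hq]; field_simp
  have hq2 : q < 1 / 2 := by rw [hq, div_lt_iff₀ hp0]; linarith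
  refine ⟨A₀ / κ, 1 / 2 - q, by positivity, by linarith, N, hN, fun n hn y hy => ?_⟩
  have hn0 : (0 : ℝ) < n := by exact_mod_cast (by omega : 0 < n)
  have hs : 0 < √(n : ℝ) := Real.sqrt_pos.2 hn0
  have hL : 0 < (n : ℝ) ^ q := by positivity
  have h1 := harmonicApprox_le_add he.toIsCentered (show n ≤ 2 * n by omega) hy hL hp hint
  have h2 : ∑ k ∈ Finset.Ico n (2 * n), ∫ a, |a| ^ p ∂(e k : Measure ℝ) ≤
      C * (2 ^ (1 + η) * (n : ℝ) ^ (1 + η)) := by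
    refine (Finset.sum_le_sum_of_subset_of_nonneg (t := Finset.range (2 * n)) ?_ ?_).trans
      ((hmom (2 * n)).trans (le_of_eq ?_))
    · intro k; simp only [Finset.mem_Ico, Finset.mem_range]; omega
    · intro k _ _; exact integral_nonneg fun a => by positivity
    · push_cast
      rw [Real.mul_rpow (by norm_num) hn0.le]
  have h3 : (n : ℝ) ^ q + ((n : ℝ) ^ q) ^ (1 - p) *
      ∑ k ∈ Finset.Ico n (2 * n), ∫ a, |a| ^ p ∂(e k : Measure ℝ) ≤ A₀ * (n : ℝ) ^ q := by
    have h4 : ((n : ℝ) ^ q) ^ (1 - p) * (n : ℝ) ^ (1 + η) = (n : ℝ) ^ q := by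
      rw [← Real.rpow_mul hn0.le, ← Real.rpow_add hn0]
      congr 1; linear_combination -hqp
    calc _ ≤ (n : ℝ) ^ q + ((n : ℝ) ^ q) ^ (1 - p) * (C * (2 ^ (1 + η) * (n : ℝ) ^ (1 + η))) := by
          gcongr
      _ = _ := by rw [hA₀]; linear_combination (C * 2 ^ (1 + η)) * h4
  have h5 := hsurv n hn y hy
  have h6 : (survival n e y).toReal ≤ e.harmonicApprox n y / (κ * √n) := by
    rw [le_div_iff₀ (by positivity)]; linarith
  have h7 : (n : ℝ) ^ (-(1 / 2 - q)) = (n : ℝ) ^ q / √n := by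
    rw [Real.sqrt_eq_rpow, ← Real.rpow_sub hn0]; congr 1; ring
  calc e.harmonicApprox (2 * n) y
      ≤ e.harmonicApprox n y + (survival n e y).toReal * (A₀ * (n : ℝ) ^ q) := by
        refine h1.trans ?_
        gcongr
    _ ≤ e.harmonicApprox n y + e.harmonicApprox n y / (κ * √n) * (A₀ * (n : ℝ) ^ q) := by
        gcongr
    _ = _ := by rw [h7]; field_simp

/-- Along dyadic times, `U n` is bounded by a multiple of `U (2 ^ j)` that tends to `1`. -/
lemma exists_harmonicApprox_le (he : e.IsGood) : ∃ β : ℕ → ℝ, Tendsto β atTop (𝓝 1) ∧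
    ∀ᶠ j in atTop, 0 ≤ β j ∧ ∀ n, ∀ y : ℝ, 0 ≤ y →
      e.harmonicApprox n y ≤ β j * e.harmonicApprox (2 ^ j) y := by
  obtain ⟨A, s, hA, hs, N, hN, h⟩ := he.harmonicApprox_two_mul_le
  set r : ℝ := 2 ^ (-s) with hr
  have hr0 : 0 < r := by positivity
  have hr1 : r < 1 := Real.rpow_lt_one_of_one_lt_of_neg (by norm_num) (by linarith)
  have hpow : ∀ j : ℕ, ((2 ^ j : ℕ) : ℝ) ^ (-s) = r ^ j := fun j => by
    push_cast
    rw [hr, ← Real.rpow_natCast, ← Real.rpow_mul (by norm_num), ← Real.rpow_mul_natCast (by norm_num),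
      mul_comm]
  -- `β j` bounds the tail product of the factors `1 + A r ^ i` over `i ≥ j`, since `1 + u ≤ exp u`
  -- and the exponents form a geometric series.
  refine ⟨fun j => Real.exp (A * (r ^ j / (1 - r))), ?_, ?_⟩
  · have h1 : Tendsto (fun j : ℕ => A * (r ^ j / (1 - r))) atTop (𝓝 (A * (0 / (1 - r)))) :=
      ((tendsto_pow_atTop_nhds_zero_of_lt_one hr0.le hr1).div_const _).const_mul _
    have h2 := (Real.continuous_exp.tendsto _).comp h1
    simpa [Function.comp_def] using h2
  · filter_upwards [eventually_ge_atTop N] with j hj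
    refine ⟨(Real.exp_pos _).le, fun n y hy => ?_⟩
    have hjN : ∀ i, N ≤ 2 ^ (j + i) := fun i =>
      hj.trans ((Nat.lt_two_pow_self (n := j)).le.trans
        (Nat.pow_le_pow_right (by norm_num) (by omega)))
    have hU : ∀ m, 0 ≤ e.harmonicApprox m y := fun m =>
      hy.trans (le_harmonicApprox he.toIsCentered m y)
    have step : ∀ i, e.harmonicApprox (2 ^ (j + i)) y ≤
        Real.exp (A * ∑ l ∈ Finset.range i, r ^ (j + l)) * e.harmonicApprox (2 ^ j) y := by
      intro i
      induction i with
      | zero => simp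
      | succ i ih =>
        have h1 := h _ (hjN i) y hy
        rw [hpow] at h1
        have h2 : 1 + A * r ^ (j + i) ≤ Real.exp (A * r ^ (j + i)) := by
          rw [add_comm]; exact Real.add_one_le_exp _
        rw [Finset.sum_range_succ, mul_add, Real.exp_add, show j + (i + 1) = (j + i) + 1 by ring,
          pow_succ' 2 (j + i)]
        calc _ ≤ _ := h1
          _ ≤ Real.exp (A * r ^ (j + i)) * (Real.exp (A * ∑ l ∈ Finset.range i, r ^ (j + l)) *
              e.harmonicApprox (2 ^ j) y) := mul_le_mul h2 ih (hU _) (Real.exp_pos _).le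
          _ = _ := by ring
    have hgeom : ∀ i, ∑ l ∈ Finset.range i, r ^ (j + l) ≤ r ^ j / (1 - r) := fun i => by
      simp_rw [pow_add, ← Finset.mul_sum]
      rw [div_eq_mul_inv]
      gcongr
      rw [← tsum_geometric_of_lt_one hr0.le hr1]
      exact (summable_geometric_of_lt_one hr0.le hr1).sum_le_tsum _ fun l _ => by positivity
    have hn : n ≤ 2 ^ (j + n) := (Nat.lt_two_pow_self (n := n)).le.trans
        (Nat.pow_le_pow_right (by norm_num) (by omega))
    refine (monotone_harmonicApprox he.toIsCentered y hn).trans ((step n).trans ?_)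
    have := hU (2 ^ j)
    gcongr
    exact hgeom n

/-- A crude bound starting from time `0` suffices, because `m` stays fixed while `y → ∞`; only
independence of `D` from `y` matters. -/
lemma exists_harmonicApprox_le_add (he : e.IsGood) (m : ℕ) : ∃ D : ℝ, ∀ y : ℝ, 0 ≤ y →
    e.harmonicApprox m y ≤ y + D := by
  obtain ⟨p, η, C, hp, hη, hη0, hC, hint, hmom⟩ := he.moment
  refine ⟨1 + ∑ k ∈ Finset.Ico 0 m, ∫ a, |a| ^ p ∂(e k : Measure ℝ), fun y hy => ?_⟩
  have h := harmonicApprox_le_add he.toIsCentered (Nat.zero_le m) hy one_pos hp hint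
  have h0 : e.harmonicApprox 0 y = y := by
    rw [harmonicApprox_eq_add_integral_overshoot he.toIsCentered]
    simp [overshoot_zero]
  have h1 : (survival 0 e y).toReal ≤ 1 := measureReal_le_one
  have h2 : 0 ≤ ∑ k ∈ Finset.Ico 0 m, ∫ a, |a| ^ p ∂(e k : Measure ℝ) :=
    Finset.sum_nonneg fun k _ => integral_nonneg fun a => by positivity
  rw [h0, Real.one_rpow, one_mul] at h
  nlinarith

lemma exists_bound (he : e.IsGood) {y : ℝ} (hy : 0 ≤ y) :
    ∃ B, ∀ n, e.harmonicApprox n y ≤ B := by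
  obtain ⟨β, -, hβ⟩ := he.exists_harmonicApprox_le
  obtain ⟨j, -, hj⟩ := hβ.exists
  exact ⟨_, fun n => hj n y hy⟩

/-- With `U_n` bounded, the survival probability is `O(1/√n)`. -/
lemma exitTime_ne_top (he : e.IsGood) {y : ℝ} (hy : 0 ≤ y) :
    ∀ᵐ x ∂e.quenched, exitTime y x ≠ ⊤ := by
  obtain ⟨B, hB⟩ := he.exists_bound hy
  obtain ⟨κ, hκ, N, hN, hsurv⟩ := he.sqrt_mul_survival_le
  have hle : ∀ n ≥ N, e.quenched.real {x | exitTime y x = ⊤} ≤ B / (κ * √n) := fun n hn => by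
    have hn0 : (0 : ℝ) < n := by exact_mod_cast (by omega : 0 < n)
    have hs : 0 < √(n : ℝ) := Real.sqrt_pos.2 hn0
    have h1 : e.quenched.real {x | exitTime y x = ⊤} ≤ (survival n e y).toReal := by
      refine ENNReal.toReal_mono (measure_ne_top _ _) (measure_mono fun x hx => ?_)
      have hx' : exitTime y x = ⊤ := hx
      change (n : WithTop ℕ) < exitTime y x
      rw [hx']; exact WithTop.coe_lt_top n
    refine h1.trans ?_
    rw [le_div_iff₀ (by positivity), mul_comm]
    exact (hsurv n hn y hy).trans (hB n)
  have hlim : Tendsto (fun n : ℕ => B / (κ * √n)) atTop (𝓝 0) :=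
    ((Real.tendsto_sqrt_atTop.comp tendsto_natCast_atTop_atTop).const_mul_atTop hκ).const_div_atTop B
  have h0 : e.quenched.real {x | exitTime y x = ⊤} ≤ 0 :=
    ge_of_tendsto hlim ((eventually_ge_atTop N).mono hle)
  rw [ae_iff]
  simp only [not_not]
  exact (measureReal_eq_zero_iff).1 (le_antisymm h0 measureReal_nonneg)

lemma ae_tendsto_overshoot (he : e.IsGood) {y : ℝ} (hy : 0 ≤ y) :
    ∀ᵐ x ∂e.quenched, Tendsto (fun n => overshoot n y x) atTop
      (𝓝 (-(y + stoppedValue walk (exitTime y) x))) := by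
  filter_upwards [he.exitTime_ne_top hy] with x hx
  obtain ⟨m, hm⟩ := WithTop.ne_top_iff_exists.1 hx
  refine tendsto_const_nhds.congr' ?_
  filter_upwards [eventually_ge_atTop m] with n hn
  rw [overshoot_of_not_lt]
  rw [← hm, not_lt]
  exact WithTop.coe_le_coe.2 hn

/-- The overshoots increase to this limit and their means `U_n - y` are bounded, so monotone
convergence applies. -/
lemma integrable_limit_overshoot (he : e.IsGood) {y : ℝ} (hy : 0 ≤ y) :
    Integrable (fun x => -(y + stoppedValue walk (exitTime y) x)) e.quenched := by
  have hlim := he.ae_tendsto_overshoot hy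
  have hc := he.toIsCentered
  obtain ⟨B, hB⟩ := he.exists_bound hy
  refine ⟨aestronglyMeasurable_of_tendsto_ae _
    (fun n => (integrable_overshoot hc n y).aestronglyMeasurable) hlim, ?_⟩
  have hnn : ∀ᵐ x ∂e.quenched, 0 ≤ -(y + stoppedValue walk (exitTime y) x) := by
    filter_upwards [hlim] with x hx
    exact ge_of_tendsto' hx fun n => overshoot_nonneg n y x
  rw [hasFiniteIntegral_iff_ofReal hnn]
  have hconv := lintegral_tendsto_of_tendsto_of_monotone
    (fun n => (integrable_overshoot hc n y).aestronglyMeasurable.aemeasurable.ennreal_ofReal)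
    (ae_of_all e.quenched fun x n m h => ENNReal.ofReal_le_ofReal (overshoot_mono y x h))
    (hlim.mono fun x hx => (ENNReal.continuous_ofReal.tendsto _).comp hx)
  refine lt_of_le_of_lt (le_of_tendsto' hconv fun n => ?_) (ENNReal.ofReal_lt_top (r := B - y))
  rw [← ofReal_integral_eq_lintegral_ofReal (integrable_overshoot hc n y)
    (ae_of_all _ fun x => overshoot_nonneg n y x)]
  refine ENNReal.ofReal_le_ofReal ?_
  have := hB n
  rw [harmonicApprox_eq_add_integral_overshoot hc] at this
  linarith

lemma integrable_stoppedValue (he : e.IsGood) {y : ℝ} (hy : 0 ≤ y) :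
    Integrable (stoppedValue walk (exitTime y)) e.quenched := by
  have h := (he.integrable_limit_overshoot hy).neg.sub (integrable_const y)
  refine h.congr (ae_of_all _ fun x => ?_)
  simp

lemma tendsto_harmonicApprox (he : e.IsGood) {y : ℝ} (hy : 0 ≤ y) :
    Tendsto (fun n => e.harmonicApprox n y) atTop (𝓝 (e.harmonic y)) := by
  have hc := he.toIsCentered
  have h := integral_tendsto_of_tendsto_of_monotone (fun n => integrable_overshoot hc n y)
    (he.integrable_limit_overshoot hy) (ae_of_all _ fun x => overshoot_mono y x)
    (he.ae_tendsto_overshoot hy)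
  simp_rw [harmonicApprox_eq_add_integral_overshoot hc]
  have h2 : e.harmonic y = y + ∫ x, -(y + stoppedValue walk (exitTime y) x) ∂e.quenched := by
    rw [harmonic, integral_neg, integral_add (integrable_const y) (he.integrable_stoppedValue hy)]
    simp
  rw [h2]
  exact h.const_add y

lemma harmonicApprox_le_harmonic (he : e.IsGood) {y : ℝ} (hy : 0 ≤ y) (n : ℕ) :
    e.harmonicApprox n y ≤ e.harmonic y :=
  (monotone_harmonicApprox he.toIsCentered y).ge_of_tendsto (he.tendsto_harmonicApprox hy) n

/-- The bound `U ≥ y` says nothing at `y = 0`; instead `U ≥ U_1`, and `U_1 > 0` because a positive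
first increment has positive probability. -/
lemma harmonic_pos (he : e.IsGood) {y : ℝ} (hy : 0 ≤ y) : 0 < e.harmonic y := by
  refine lt_of_lt_of_le ?_ (he.harmonicApprox_le_harmonic hy 1)
  rw [harmonicApprox_eq_integral_killedWalk,
    integral_pos_iff_support_of_nonneg (fun x => ?_) (integrable_killedWalk he.toIsCentered 1 y)]
  · have h1 : e.quenched ((fun x : ℕ → ℝ => x 0) ⁻¹' Set.Ioi 0) = (e 0 : Measure ℝ) (Set.Ioi 0) :=
      (measurePreserving_eval e 0).measure_preimage measurableSet_Ioi.nullMeasurableSet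
    refine lt_of_lt_of_le (h1 ▸ he.pos 0) (measure_mono fun x hx => ?_)
    have hx' : 0 < x 0 := hx
    have hlt : ((1 : ℕ) : WithTop ℕ) < exitTime y x := by
      rw [lt_exitTime_iff]
      intro k h1 h2
      obtain rfl : k = 1 := le_antisymm h2 h1
      rw [walk_one]; linarith
    rw [Function.mem_support, killedWalk_of_lt hlt, walk_one]
    linarith
  · by_cases h : ((1 : ℕ) : WithTop ℕ) < exitTime y x
    · rw [killedWalk_of_lt h]; exact nonneg_of_lt_exitTime hy h
    · rw [killedWalk_of_not_lt h]; rfl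

lemma harmonic_monotoneOn (he : e.IsGood) : MonotoneOn e.harmonic (Set.Ici 0) := by
  intro y hy z hz hyz
  have hy' : 0 ≤ y := hy
  have hz' : 0 ≤ z := hz
  refine le_of_tendsto_of_tendsto' (he.tendsto_harmonicApprox hy) (he.tendsto_harmonicApprox hz)
    fun n => ?_
  have h := killedMean_mono n e hyz
  rw [killedMean_eq_ofReal he.toIsCentered n hy', killedMean_eq_ofReal he.toIsCentered n hz'] at h
  exact (ENNReal.ofReal_le_ofReal_iff (hz'.trans (le_harmonicApprox he.toIsCentered n z))).1 h

/-- From below, `U ≥ y`. From above, `U ≤ β_j U_{2^j} ≤ β_j (y + D)`, where `j` is fixed first to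
bring `β_j` close to `1`. -/
lemma tendsto_harmonic_div (he : e.IsGood) :
    Tendsto (fun y : ℝ => e.harmonic y / y) atTop (𝓝 1) := by
  obtain ⟨β, hβ1, hβ⟩ := he.exists_harmonicApprox_le
  refine tendsto_order.2 ⟨fun c hc => ?_, fun c hc => ?_⟩
  · filter_upwards [eventually_gt_atTop 0] with y hy
    refine hc.trans_le ((one_le_div hy).2 ?_)
    exact (le_harmonicApprox he.toIsCentered 0 y).trans (he.harmonicApprox_le_harmonic hy.le 0)
  · obtain ⟨j, ⟨hj0, hj⟩, hjc⟩ := (hβ.and (hβ1.eventually_lt_const hc)).exists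
    obtain ⟨D, hD⟩ := he.exists_harmonicApprox_le_add (2 ^ j)
    have hlim : Tendsto (fun y : ℝ => β j * (1 + D / y)) atTop (𝓝 (β j * (1 + 0))) :=
      ((tendsto_id.const_div_atTop D).const_add 1).const_mul _
    rw [add_zero, mul_one] at hlim
    filter_upwards [eventually_gt_atTop 0, hlim.eventually_lt_const hjc] with y hy hyc
    refine lt_of_le_of_lt ?_ hyc
    rw [div_le_iff₀ hy]
    refine le_of_tendsto' (he.tendsto_harmonicApprox hy.le) fun n => (hj n y hy.le).trans ?_
    have h1 : β j * (1 + D / y) * y = β j * (y + D) := by field_simp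
    rw [h1]
    gcongr
    exact hD y hy.le

/-! ### The harmonic property -/

lemma setOf_one_lt_exitTime (y : ℝ) :
    {x | (1 : WithTop ℕ) < exitTime y x} = (fun x : ℕ → ℝ => x 0) ⁻¹' {a | 0 < y + a} := by
  ext x
  change ((1 : ℕ) : WithTop ℕ) < exitTime y x ↔ 0 < y + x 0
  rw [lt_exitTime_iff]
  constructor
  · intro h; simpa [walk_one] using h 1 le_rfl le_rfl
  · intro h k h1 h2
    obtain rfl : k = 1 := le_antisymm h2 h1
    simpa [walk_one] using h

/-- The recursion `killedMean_succ` passes to the limit by monotone convergence in `ℝ≥0∞`.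
Integrability need not be known beforehand: it follows from finiteness of `U(e, y)`. -/
lemma harmonic_eq_setIntegral (he : e.IsGood) (hs : e.shift.IsGood) {y : ℝ} (hy : 0 ≤ y) :
    IntegrableOn (fun x => e.shift.harmonic (y + walk 1 x))
        {x | (1 : WithTop ℕ) < exitTime y x} e.quenched ∧
      e.harmonic y = ∫ x in {x | (1 : WithTop ℕ) < exitTime y x},
        e.shift.harmonic (y + walk 1 x) ∂e.quenched := by
  set F : ℝ → ℝ≥0∞ := Set.indicator {a | 0 < y + a}
    fun a => ENNReal.ofReal (e.shift.harmonic (y + a)) with hF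
  set G : ℕ → ℝ → ℝ≥0∞ := fun n => Set.indicator {a | 0 < y + a}
    fun a => killedMean n e.shift (y + a) with hG
  have hset : MeasurableSet {a : ℝ | 0 < y + a} :=
    measurableSet_lt measurable_const (measurable_id.const_add y)
  have hGm : ∀ n, Measurable (G n) := fun n =>
    ((killedMean_mono n e.shift).measurable.comp (measurable_id.const_add y)).indicator hset
  have hGmono : ∀ a, Monotone fun n => G n a := by
    intro a n m h
    simp only [hG, Set.indicator]
    split_ifs with ha
    · have ha' : 0 ≤ y + a := le_of_lt ha
      rw [killedMean_eq_ofReal hs.toIsCentered n ha', killedMean_eq_ofReal hs.toIsCentered m ha']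
      exact ENNReal.ofReal_le_ofReal (monotone_harmonicApprox hs.toIsCentered _ h)
    · exact le_rfl
  have hGF : ∀ a, Tendsto (fun n => G n a) atTop (𝓝 (F a)) := by
    intro a
    simp only [hG, hF, Set.indicator]
    split_ifs with ha
    · have ha' : 0 ≤ y + a := le_of_lt ha
      simp_rw [killedMean_eq_ofReal hs.toIsCentered _ ha']
      exact (ENNReal.continuous_ofReal.tendsto _).comp (hs.tendsto_harmonicApprox ha')
    · exact tendsto_const_nhds
  -- Measurability in the starting point comes from the approximations, which are monotone in it.
  have hFm : Measurable F := measurable_of_tendsto_metrizable hGm (tendsto_pi_nhds.2 hGF)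
  have hconv := lintegral_tendsto_of_tendsto_of_monotone (μ := (e 0 : Measure ℝ))
    (fun n => (hGm n).aemeasurable) (ae_of_all _ hGmono) (ae_of_all _ hGF)
  have hconv2 : Tendsto (fun n => ∫⁻ a, G n a ∂(e 0 : Measure ℝ)) atTop
      (𝓝 (ENNReal.ofReal (e.harmonic y))) := by
    have : ∀ n, ∫⁻ a, G n a ∂(e 0 : Measure ℝ) =
        ENNReal.ofReal (e.harmonicApprox (n + 1) y) := fun n => by
      rw [← killedMean_eq_ofReal he.toIsCentered _ hy, killedMean_succ]
    simp_rw [this]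
    exact (ENNReal.continuous_ofReal.tendsto _).comp
      ((he.tendsto_harmonicApprox hy).comp (tendsto_add_atTop_nat 1))
  have hFint : ∫⁻ a, F a ∂(e 0 : Measure ℝ) = ENNReal.ofReal (e.harmonic y) :=
    tendsto_nhds_unique hconv hconv2
  have hFreal : ∀ x : ℕ → ℝ, (F (x 0)).toReal =
      Set.indicator {x | (1 : WithTop ℕ) < exitTime y x}
        (fun x => e.shift.harmonic (y + walk 1 x)) x := by
    intro x
    rw [setOf_one_lt_exitTime]
    simp only [hF, Set.indicator, Set.mem_preimage, walk_one]
    split_ifs with ha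
    · exact ENNReal.toReal_ofReal (hs.harmonic_pos (le_of_lt ha)).le
    · rfl
  have hmeas : MeasurableSet {x | (1 : WithTop ℕ) < exitTime y x} := by
    rw [setOf_one_lt_exitTime]; exact (measurable_pi_apply 0) hset
  have hFi : Integrable (fun a => (F a).toReal) (e 0 : Measure ℝ) :=
    integrable_toReal_of_lintegral_ne_top hFm.aemeasurable (by rw [hFint]; simp)
  have hFlt : ∀ᵐ a ∂(e 0 : Measure ℝ), F a < ∞ :=
    ae_lt_top hFm (by rw [hFint]; simp)
  constructor
  · rw [← integrable_indicator_iff hmeas]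
    exact (integrable_eval e 0 hFi).congr (ae_of_all _ hFreal)
  · rw [← integral_indicator hmeas, ← integral_congr_ae (ae_of_all _ hFreal),
      integral_eval e 0 (g := fun a => (F a).toReal) hFm.ennreal_toReal.stronglyMeasurable,
      integral_toReal hFm.aemeasurable hFlt, hFint, ENNReal.toReal_ofReal (he.harmonic_pos hy).le]

end IsGood

end Env

/-! ### A one-sided pointwise ergodic theorem -/

/-- The maximum of the Birkhoff sums over at most `n` steps, including the empty one. -/
def birkhoffMax {α : Type*} (T : α → α) (g : α → ℝ) : ℕ → α → ℝ
  | 0, _ => 0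
  | n + 1, x => max 0 (g x + birkhoffMax T g n (T x))

section Maximal

variable {α : Type*} {T : α → α} {g : α → ℝ}

lemma birkhoffMax_succ (n : ℕ) (x : α) :
    birkhoffMax T g (n + 1) x = max 0 (g x + birkhoffMax T g n (T x)) := rfl

lemma birkhoffMax_nonneg (n : ℕ) (x : α) : 0 ≤ birkhoffMax T g n x := by
  cases n with
  | zero => exact le_rfl
  | succ n => exact le_max_left _ _

lemma birkhoffMax_le_succ (n : ℕ) (x : α) : birkhoffMax T g n x ≤ birkhoffMax T g (n + 1) x := by
  induction n generalizing x with
  | zero => exact birkhoffMax_nonneg 1 x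
  | succ n ih =>
    rw [birkhoffMax_succ, birkhoffMax_succ (n + 1)]
    gcongr
    exact ih (T x)

lemma birkhoffMax_mono (x : α) : Monotone fun n => birkhoffMax T g n x :=
  monotone_nat_of_le_succ fun n => birkhoffMax_le_succ n x

lemma birkhoffSum_le_birkhoffMax (n : ℕ) (x : α) : birkhoffSum T g n x ≤ birkhoffMax T g n x := by
  induction n generalizing x with
  | zero => simp [birkhoffMax]
  | succ n ih =>
    rw [birkhoffSum_succ', birkhoffMax_succ]
    exact le_max_of_le_right (by linarith [ih (T x)])

/-- Where the maximum is positive it equals `g x` plus a maximum from `T x` over fewer steps;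
elsewhere it vanishes. The integral of the left side is zero by invariance, which yields the maximal
inequality. -/
lemma birkhoffMax_sub_le (n : ℕ) (x : α) :
    birkhoffMax T g n x - birkhoffMax T g n (T x) ≤
      Set.indicator {x | 0 < birkhoffMax T g n x} g x := by
  by_cases h : 0 < birkhoffMax T g n x
  · rw [Set.indicator_of_mem (by exact h)]
    cases n with
    | zero => exact absurd h (lt_irrefl _)
    | succ n =>
      have h1 := birkhoffMax_le_succ (T := T) (g := g) n (T x)
      rw [birkhoffMax_succ] at h
      have h2 : 0 < g x + birkhoffMax T g n (T x) := by
        by_contra h3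
        rw [max_eq_left (not_lt.1 h3)] at h
        exact lt_irrefl _ h
      rw [birkhoffMax_succ n x, max_eq_right h2.le]
      linarith
  · rw [Set.indicator_of_notMem (by exact h)]
    linarith [not_lt.1 h, birkhoffMax_nonneg (T := T) (g := g) n (T x)]

variable [MeasurableSpace α] {μ : Measure α}

lemma measurable_birkhoffMax (hT : Measurable T) (hg : Measurable g) (n : ℕ) :
    Measurable (birkhoffMax T g n) := by
  induction n with
  | zero => exact measurable_const
  | succ n ih => exact measurable_const.max (hg.add (ih.comp hT))

lemma integrable_birkhoffMax [IsFiniteMeasure μ] (hT : MeasurePreserving T μ μ)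
    (hg : Integrable g μ) (n : ℕ) : Integrable (birkhoffMax T g n) μ := by
  induction n with
  | zero => exact integrable_const (0 : ℝ)
  | succ n ih =>
    exact (integrable_const (0 : ℝ)).sup (hg.add (hT.integrable_comp_of_integrable ih))

/-- A consequence of the maximal ergodic inequality. -/
lemma integral_nonneg_of_exists_birkhoffSum_pos [IsFiniteMeasure μ]
    (hT : MeasurePreserving T μ μ) (hgm : Measurable g) (hg : Integrable g μ)
    (h : ∀ᵐ x ∂μ, ∃ n, 0 < birkhoffSum T g n x) : 0 ≤ ∫ x, g x ∂μ := by
  have hset : ∀ n, MeasurableSet {x | 0 < birkhoffMax T g n x} := fun n =>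
    measurableSet_lt measurable_const (measurable_birkhoffMax hT.measurable hgm n)
  have hn : ∀ n, 0 ≤ ∫ x, Set.indicator {x | 0 < birkhoffMax T g n x} g x ∂μ := fun n => by
    have hi := integrable_birkhoffMax hT hg n
    have hi2 : Integrable (fun x => birkhoffMax T g n (T x)) μ :=
      hT.integrable_comp_of_integrable hi
    have h1 : ∫ x, birkhoffMax T g n (T x) ∂μ = ∫ x, birkhoffMax T g n x ∂μ := by
      have h2 := integral_map (μ := μ) hT.measurable.aemeasurable
        (f := birkhoffMax T g n) (by rw [hT.map_eq]; exact hi.aestronglyMeasurable)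
      rw [hT.map_eq] at h2
      exact h2.symm
    have h3 := integral_mono (hi.sub hi2) (hg.indicator (hset n))
      fun x => birkhoffMax_sub_le (T := T) (g := g) n x
    have h4 : ∫ x, (birkhoffMax T g n x - birkhoffMax T g n (T x)) ∂μ = 0 := by
      rw [integral_sub hi hi2, h1, sub_self]
    exact h4 ▸ h3
  -- By hypothesis the increasing sets `{birkhoffMax > 0}` exhaust almost all of the space.
  have hlim : Tendsto (fun n => ∫ x, Set.indicator {x | 0 < birkhoffMax T g n x} g x ∂μ) atTop
      (𝓝 (∫ x, g x ∂μ)) := by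
    refine tendsto_integral_of_dominated_convergence (fun x => ‖g x‖)
      (fun n => (hg.indicator (hset n)).aestronglyMeasurable) hg.norm
      (fun n => ae_of_all _ fun x => norm_indicator_le_norm_self _ _) ?_
    filter_upwards [h] with x ⟨m, hm⟩
    refine tendsto_const_nhds.congr' ?_
    filter_upwards [eventually_ge_atTop m] with n hmn
    rw [Set.indicator_of_mem]
    exact hm.trans_le ((birkhoffSum_le_birkhoffMax m x).trans (birkhoffMax_mono x hmn))
  exact ge_of_tendsto' hlim hn

/-- Birkhoff sums of a function with negative mean are bounded above. -/
lemma Ergodic.ae_bddAbove_birkhoffSum [IsProbabilityMeasure μ] (hT : Ergodic T μ)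
    (hgm : Measurable g) (hg : Integrable g μ) (hneg : ∫ x, g x ∂μ < 0) :
    ∀ᵐ x ∂μ, ∃ K : ℝ, ∀ n, birkhoffSum T g n x ≤ K := by
  set D : Set α := {x | ∀ K : ℕ, ∃ n, (K : ℝ) < birkhoffSum T g n x} with hD
  have hsum : ∀ n, Measurable (birkhoffSum T g n) := fun n =>
    Finset.measurable_sum _ fun k _ => hgm.comp (hT.measurable.iterate k)
  have hDm : MeasurableSet D := by
    simp only [hD, Set.ofPred_forall, Set.ofPred_exists]
    exact MeasurableSet.iInter fun K => MeasurableSet.iUnion fun n =>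
      measurableSet_lt measurable_const (hsum n)
  -- The sums along the orbits of `x` and `T x` differ by the fixed number `g x`, so they are
  -- unbounded above together. By ergodicity `D` is null or full, and full is excluded by the sign
  -- of the mean.
  have hDinv : T ⁻¹' D = D := by
    ext x
    simp only [hD, Set.mem_preimage, Set.mem_ofPred_eq]
    constructor
    · intro h K
      obtain ⟨K', hK'⟩ := exists_nat_ge (K - g x)
      obtain ⟨n, hn⟩ := h K'
      exact ⟨n + 1, by rw [birkhoffSum_succ']; linarith⟩
    · intro h K
      obtain ⟨K', hK'⟩ := exists_nat_ge (K + g x)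
      obtain ⟨n, hn⟩ := h K'
      cases n with
      | zero =>
        rw [birkhoffSum_zero] at hn
        exact absurd hn (not_lt.2 (Nat.cast_nonneg K'))
      | succ n =>
        rw [birkhoffSum_succ'] at hn
        exact ⟨n, by linarith⟩
  rcases hT.toPreErgodic.ae_mem_or_ae_notMem hDm hDinv with h | h
  · refine absurd (integral_nonneg_of_exists_birkhoffSum_pos hT.toMeasurePreserving hgm hg ?_)
      (not_le.2 hneg)
    filter_upwards [h] with x hx
    simpa using hx 0
  · filter_upwards [h] with x hx
    simp only [hD, Set.mem_ofPred_eq, not_forall, not_exists, not_lt] at hx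
    obtain ⟨K, hK⟩ := hx
    exact ⟨K, hK⟩

lemma MeasureTheory.MeasurePreserving.ae_forall_iterate (hT : MeasurePreserving T μ μ)
    {p : α → Prop} (h : ∀ᵐ x ∂μ, p x) : ∀ᵐ x ∂μ, ∀ n, p (T^[n] x) :=
  ae_all_iff.2 fun n => (hT.iterate n).quasiMeasurePreserving.ae h

/-- The terms of a stationary integrable sequence sum up to `O(n ^ s)` for every `s > 1`. -/
lemma MeasureTheory.MeasurePreserving.ae_exists_sum_le (hT : MeasurePreserving T μ μ)
    {m : α → ℝ≥0∞} (hm : Measurable m) (hfin : ∫⁻ x, m x ∂μ ≠ ∞) {s : ℝ} (hs : 1 < s) :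
    ∀ᵐ x ∂μ, ∃ C : ℝ, 0 ≤ C ∧ ∀ n : ℕ, ∑ k ∈ Finset.range n, m (T^[k] x) ≤
      ENNReal.ofReal (C * (n : ℝ) ^ s) := by
  -- The weights are summable, so the weighted series has finite mean and is finite almost
  -- everywhere; its value serves as `C`, since `n ^ s * w k ≥ 1` for `k < n`.
  set w : ℕ → ℝ≥0∞ := fun k => ENNReal.ofReal (((k + 1 : ℕ) : ℝ) ^ (-s)) with hw
  have hmk : ∀ k, Measurable fun x => m (T^[k] x) := fun k =>
    hm.comp (hT.measurable.iterate k)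
  have htot : ∫⁻ x, ∑' k, w k * m (T^[k] x) ∂μ ≠ ∞ := by
    rw [lintegral_tsum fun k => ((hmk k).const_mul _).aemeasurable]
    have : ∀ k, ∫⁻ x, w k * m (T^[k] x) ∂μ = w k * ∫⁻ x, m x ∂μ := fun k => by
      rw [lintegral_const_mul _ (hmk k), (hT.iterate k).lintegral_comp hm]
    simp_rw [this]
    rw [ENNReal.tsum_mul_right]
    refine ENNReal.mul_ne_top ?_ hfin
    have hsum : Summable fun k : ℕ => ((k + 1 : ℕ) : ℝ) ^ (-s) :=
      (summable_nat_add_iff 1).2 (Real.summable_nat_rpow.2 (by linarith))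
    rw [hw, ← ENNReal.ofReal_tsum_of_nonneg (fun k => by positivity) hsum]
    exact ENNReal.ofReal_ne_top
  have hae := ae_lt_top (Measurable.tsum fun k => (hmk k).const_mul (w k)) htot
  filter_upwards [hae] with x hx
  refine ⟨(∑' k, w k * m (T^[k] x)).toReal, ENNReal.toReal_nonneg, fun n => ?_⟩
  rw [ENNReal.ofReal_mul ENNReal.toReal_nonneg, ENNReal.ofReal_toReal hx.ne, mul_comm]
  refine le_trans ?_ (mul_le_mul_right (ENNReal.sum_le_tsum (Finset.range n)) _)
  rw [Finset.mul_sum]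
  refine Finset.sum_le_sum fun k hk => ?_
  rw [← mul_assoc, hw, ← ENNReal.ofReal_mul (by positivity)]
  refine le_mul_of_one_le_left zero_le ?_
  rw [ENNReal.one_le_ofReal, Real.rpow_neg (by positivity), ← div_eq_mul_inv,
    one_le_div (by positivity)]
  have : k + 1 ≤ n := Finset.mem_range.1 hk
  exact Real.rpow_le_rpow (by positivity) (by exact_mod_cast this) (by linarith)

end Maximal

namespace Env

/-! ### Measurability in the environment -/

/-- The law of the first increment, as a kernel. -/
noncomputable def headKernel : Kernel Env ℝ :=
  ⟨fun e => (e 0 : Measure ℝ), measurable_subtype_coe.comp (measurable_pi_apply 0)⟩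

instance : IsMarkovKernel headKernel := ⟨fun e => inferInstanceAs (IsProbabilityMeasure (e 0 : Measure ℝ))⟩

/-- The quenched law, as a kernel. -/
noncomputable def quenchedKernel : Kernel Env (ℕ → ℝ) := ⟨quenched, measurable_quenched⟩

instance : IsMarkovKernel quenchedKernel :=
  ⟨fun e => inferInstanceAs (IsProbabilityMeasure e.quenched)⟩

lemma measurableSet_exitTime_eq (y : ℝ) (t : WithTop ℕ) :
    MeasurableSet {x | exitTime y x = t} := by
  have h : {x | exitTime y x = t} =
      ⋂ n : ℕ, {x | (n : WithTop ℕ) < exitTime y x ↔ (n : WithTop ℕ) < t} := by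
    ext x
    simp only [Set.mem_ofPred_eq, Set.mem_iInter]
    constructor
    · rintro rfl n; rfl
    · intro h
      refine le_antisymm (not_lt.1 fun hlt => ?_) (not_lt.1 fun hlt => ?_)
      · obtain ⟨k, hk⟩ := WithTop.ne_top_iff_exists.1 hlt.ne_top
        exact ((h k).1 (lt_of_eq_of_lt hk hlt)).ne hk
      · obtain ⟨k, hk⟩ := WithTop.ne_top_iff_exists.1 hlt.ne_top
        exact ((h k).2 (lt_of_eq_of_lt hk hlt)).ne hk
  rw [h]
  refine MeasurableSet.iInter fun n => ?_
  by_cases hn : (n : WithTop ℕ) < t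
  · simpa only [hn, iff_true] using measurableSet_lt_exitTime n y
  · simp only [hn, iff_false]
    exact (measurableSet_lt_exitTime n y).compl

lemma measurable_stoppedValue_walk (y : ℝ) : Measurable (stoppedValue walk (exitTime y)) := by
  intro s hs
  -- The path space splits into countably many events; on `τ_y = ⊤` the stopped value is the walk at
  -- the default time of `untopA`, which is still measurable.
  have h : stoppedValue walk (exitTime y) ⁻¹' s =
      ⋃ t : WithTop ℕ, {x | exitTime y x = t} ∩ walk t.untopA ⁻¹' s := by
    ext x
    simp [stoppedValue]
  rw [h]
  have : Countable (WithTop ℕ) := inferInstanceAs (Countable (Option ℕ))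
  exact MeasurableSet.iUnion fun t =>
    (measurableSet_exitTime_eq y t).inter (measurable_walk _ hs)

lemma measurable_harmonic (y : ℝ) : Measurable fun e : Env => e.harmonic y :=
  (StronglyMeasurable.integral_kernel (κ := quenchedKernel)
    (measurable_stoppedValue_walk y).stronglyMeasurable).measurable.neg

/-! ### Almost every environment is good -/

lemma shift_iterate_zero (k : ℕ) (e : Env) : shift^[k] e 0 = e k := by
  have h : ∀ n, shift^[k] e n = e (n + k) := by
    induction k with
    | zero => intro n; rfl
    | succ k ih =>
      intro n
      rw [Function.iterate_succ_apply', shift, ih]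
      congr 1; ring
  simpa using h 0

lemma exists_measureReal_Ioi_pos {μ : Measure Env} [IsProbabilityMeasure μ]
    (hpos : ∀ᵐ e ∂μ, 0 < (e 0 : Measure ℝ) (Set.Ioi 0)) :
    ∃ δ : ℝ, 0 < δ ∧ 0 < ∫ e : Env, (e 0 : Measure ℝ).real (Set.Ioi δ) ∂μ := by
  by_contra! hcon
  have hint : ∀ δ : ℝ, Integrable (fun e : Env => (e 0 : Measure ℝ).real (Set.Ioi δ)) μ := fun δ =>
    Integrable.of_bound ((measurable_apply_set 0 measurableSet_Ioi).ennreal_toReal.aestronglyMeasurable)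
      1 (ae_of_all _ fun e => by
        rw [Real.norm_of_nonneg measureReal_nonneg]; exact measureReal_le_one)
  -- If no level `δ` worked, all the half-lines above `1 / (m + 1)` would be null for almost every
  -- environment, and so would their union `Ioi 0`.
  have hz : ∀ m : ℕ, ∀ᵐ e : Env ∂μ, (e 0 : Measure ℝ).real (Set.Ioi (1 / ((m : ℝ) + 1))) = 0 := by
    intro m
    have h1 := hcon (1 / ((m : ℝ) + 1)) (by positivity)
    have h2 := (integral_eq_zero_iff_of_nonneg (fun e : Env => measureReal_nonneg)
      (hint (1 / ((m : ℝ) + 1)))).1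
      (le_antisymm h1 (integral_nonneg fun e : Env => measureReal_nonneg))
    exact h2
  obtain ⟨e, he, hpe⟩ := ((ae_all_iff.2 hz).and hpos).exists
  have hU : Set.Ioi (0 : ℝ) = ⋃ m : ℕ, Set.Ioi (1 / ((m : ℝ) + 1)) := by
    ext a
    simp only [Set.mem_Ioi, Set.mem_iUnion]
    exact ⟨fun ha => exists_nat_one_div_lt ha, fun ⟨m, hm⟩ => lt_trans (by positivity) hm⟩
  rw [hU] at hpe
  exact hpe.ne' (measure_iUnion_null fun m => (measureReal_eq_zero_iff).1 (he m))

lemma ae_isGood {μ : Measure Env} [IsProbabilityMeasure μ] (herg : Ergodic shift μ)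
    (hmean : ∀ᵐ e ∂μ, ∫ a, a ∂((e : Env) 0 : Measure ℝ) = 0) {ε : ℝ} (hε : 0 < ε)
    (hmoment : ∫⁻ e : Env, ∫⁻ a, ENNReal.ofReal (|a| ^ (2 + ε)) ∂(e 0 : Measure ℝ) ∂μ ≠ ∞)
    (hpos : ∀ᵐ e ∂μ, 0 < ((e : Env) 0 : Measure ℝ) (Set.Ioi 0)) :
    ∀ᵐ e ∂μ, e.IsGood := by
  have hmp := herg.toMeasurePreserving
  have hpm : Measurable fun a : ℝ => ENNReal.ofReal (|a| ^ (2 + ε)) := by fun_prop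
  have hm : Measurable fun e : Env => ∫⁻ a, ENNReal.ofReal (|a| ^ (2 + ε)) ∂(e 0 : Measure ℝ) :=
    hpm.lintegral_kernel (κ := headKernel)
  obtain ⟨δ, hδ, hδpos⟩ := exists_measureReal_Ioi_pos hpos
  set f : Env → ℝ := fun e => (e 0 : Measure ℝ).real (Set.Ioi δ) with hf
  have hfm : Measurable f := (measurable_apply_set 0 measurableSet_Ioi).ennreal_toReal
  have hfi : Integrable f μ := Integrable.of_bound hfm.aestronglyMeasurable 1
    (ae_of_all _ fun e => by
      rw [Real.norm_of_nonneg measureReal_nonneg]; exact measureReal_le_one)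
  -- Half the mean makes `c - f` have strictly negative mean, so its Birkhoff sums are bounded above
  -- by some `K`; this is `spread`.
  set c := (∫ e, f e ∂μ) / 2 with hc
  have hbdd := herg.ae_bddAbove_birkhoffSum (g := fun e => c - f e) (measurable_const.sub hfm)
    ((integrable_const c).sub hfi) (by
      rw [integral_sub (integrable_const c) hfi]
      simp only [integral_const, probReal_univ, smul_eq_mul, one_mul]
      rw [hc]; linarith)
  filter_upwards [hmp.ae_forall_iterate hmean, hmp.ae_forall_iterate hpos,
    hmp.ae_forall_iterate (ae_lt_top hm hmoment), hbdd,
    hmp.ae_exists_sum_le hm hmoment (show 1 < 1 + ε / 4 by linarith)] with e h1 h2 h3 h4 h5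
  simp only [shift_iterate_zero] at h1 h2 h3 h5
  have hmeasp : Measurable fun a : ℝ => |a| ^ (2 + ε) := by fun_prop
  have hint : ∀ k, Integrable (fun a : ℝ => |a| ^ (2 + ε)) (e k : Measure ℝ) := fun k => by
    refine ⟨hmeasp.aestronglyMeasurable, ?_⟩
    rw [hasFiniteIntegral_iff_ofReal (ae_of_all _ fun a => by positivity)]
    exact h3 k
  refine ⟨⟨fun k => ?_, h1⟩, ?_, ?_, h2⟩
  -- A vanishing Bochner integral does not entail integrability, which is derived from the moment of
  -- order `2 + ε`.
  · refine ((integrable_const (1 : ℝ)).add (hint k)).mono' measurable_id.aestronglyMeasurable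
      (ae_of_all _ fun a => ?_)
    simpa using abs_le_add_rpow_mul one_pos (show (1 : ℝ) ≤ 2 + ε by linarith) a
  · obtain ⟨C, hC, hsum⟩ := h5
    -- Here `p / 2 = 1 + ε / 2` exceeds `1 + η = 1 + ε / 4`.
    refine ⟨2 + ε, ε / 4, C, by linarith, by linarith, by linarith, hC, hint, fun n => ?_⟩
    have h6 : ∑ k ∈ Finset.range n, ∫⁻ a, ENNReal.ofReal (|a| ^ (2 + ε)) ∂(e k : Measure ℝ) =
        ENNReal.ofReal (∑ k ∈ Finset.range n, ∫ a, |a| ^ (2 + ε) ∂(e k : Measure ℝ)) := by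
      rw [ENNReal.ofReal_sum_of_nonneg fun k _ => integral_nonneg fun a => by positivity]
      exact Finset.sum_congr rfl fun k _ =>
        (ofReal_integral_eq_lintegral_ofReal (hint k) (ae_of_all _ fun a => by positivity)).symm
    have h7 := hsum n
    rwa [h6, ENNReal.ofReal_le_ofReal_iff (by positivity)] at h7
  · obtain ⟨K, hK⟩ := h4
    refine ⟨δ, c, K, hδ, by rw [hc]; linarith, fun n => ?_⟩
    have h6 := hK n
    simp only [birkhoffSum, hf, shift_iterate_zero, Finset.sum_sub_distrib, Finset.sum_const,
      Finset.card_range, nsmul_eq_mul] at h6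
    linarith

end Env

/-! ### Transfer from the law of the environment to the probability space -/

theorem mainTheorem2 {Ω : Type*} [MeasurableSpace Ω] (P : Measure Ω) [IsProbabilityMeasure P]
    (ξ : Ω → Env)
    -- the environment is a sequence of random probability laws, stationary and ergodic
    (hξ : ∀ n, Measurable fun ω => ξ ω n)
    (herg : Ergodic Env.shift (P.map ξ))
    -- `E_ξ(X₁) = 0` almost surely
    (hmean : ∀ᵐ ω ∂P, ∫ x, x 0 ∂(ξ ω).quenched = 0)
    -- `E(|X₁|^(2+ε)) < ∞` for some `ε > 0`
    (hmoment : ∃ ε : ℝ, 0 < ε ∧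
      ∫⁻ ω, ∫⁻ x, ENNReal.ofReal (|x 0| ^ (2 + ε)) ∂(ξ ω).quenched ∂P < ∞)
    -- `P_ξ(X₁ > 0) > 0` almost surely
    (hpos : ∀ᵐ ω ∂P, 0 < (ξ ω).quenched {x | 0 < x 0}) :
    -- `U` is well defined and is the limit of `U_n`
    (∀ᵐ ω ∂P, ∀ y : ℝ, 0 ≤ y →
      (∀ᵐ x ∂(ξ ω).quenched, exitTime y x ≠ ⊤) ∧
      Integrable (stoppedValue walk (exitTime y)) (ξ ω).quenched ∧
      Tendsto (fun n => (ξ ω).harmonicApprox n y) atTop (𝓝 ((ξ ω).harmonic y))) ∧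
    -- `U` is `σ(ξ)`-measurable
    (∀ y : ℝ, 0 ≤ y →
      Measurable[MeasurableSpace.comap ξ inferInstance] fun ω => (ξ ω).harmonic y) ∧
    -- quenched harmonic property
    (∀ᵐ ω ∂P, ∀ y : ℝ, 0 ≤ y →
      IntegrableOn (fun x => (ξ ω).shift.harmonic (y + walk 1 x))
        {x | (1 : WithTop ℕ) < exitTime y x} (ξ ω).quenched ∧
      (ξ ω).harmonic y = ∫ x in {x | (1 : WithTop ℕ) < exitTime y x},
        (ξ ω).shift.harmonic (y + walk 1 x) ∂(ξ ω).quenched) ∧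
    -- positivity, monotonicity and growth
    (∀ᵐ ω ∂P, (∀ y : ℝ, 0 ≤ y → 0 < (ξ ω).harmonic y) ∧
      MonotoneOn (ξ ω).harmonic (Set.Ici 0) ∧
      Tendsto (fun y : ℝ => (ξ ω).harmonic y / y) atTop (𝓝 1)) := by
  have hξm : Measurable ξ := measurable_pi_lambda _ hξ
  have : IsProbabilityMeasure (P.map ξ) := Measure.isProbabilityMeasure_map hξm.aemeasurable
  obtain ⟨ε, hε, hmom⟩ := hmoment
  have hmean' : ∀ᵐ e ∂(P.map ξ), ∫ a, a ∂((e : Env) 0 : Measure ℝ) = 0 := by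
    have hmeas : Measurable fun e : Env => ∫ a, a ∂(e 0 : Measure ℝ) :=
      (StronglyMeasurable.integral_kernel (κ := Env.headKernel)
        (stronglyMeasurable_id (α := ℝ))).measurable
    refine (ae_map_iff hξm.aemeasurable (hmeas (measurableSet_singleton 0))).2 ?_
    filter_upwards [hmean] with ω hω
    exact (Env.integral_eval (ξ ω) 0 stronglyMeasurable_id).symm.trans hω
  have hpos' : ∀ᵐ e ∂(P.map ξ), 0 < ((e : Env) 0 : Measure ℝ) (Set.Ioi 0) := by
    rw [ae_map_iff hξm.aemeasurable (measurableSet_lt measurable_const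
      (Env.measurable_apply_set 0 measurableSet_Ioi))]
    filter_upwards [hpos] with ω hω
    rwa [← (Env.measurePreserving_eval (ξ ω) 0).measure_preimage
      measurableSet_Ioi.nullMeasurableSet]
  have hmom' : ∫⁻ e : Env, ∫⁻ a, ENNReal.ofReal (|a| ^ (2 + ε)) ∂(e 0 : Measure ℝ) ∂(P.map ξ)
      ≠ ∞ := by
    have hpm : Measurable fun a : ℝ => ENNReal.ofReal (|a| ^ (2 + ε)) := by fun_prop
    have hm : Measurable fun e : Env =>
        ∫⁻ a, ENNReal.ofReal (|a| ^ (2 + ε)) ∂(e 0 : Measure ℝ) :=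
      hpm.lintegral_kernel (κ := Env.headKernel)
    rw [lintegral_map hm hξm]
    simp_rw [← fun ω => (Env.measurePreserving_eval (ξ ω) 0).lintegral_comp hpm]
    exact hmom.ne
  have hgood := Env.ae_isGood herg hmean' hε hmom' hpos'
  have hgood1 : ∀ᵐ ω ∂P, (ξ ω).IsGood := ae_of_ae_map hξm.aemeasurable hgood
  -- By stationarity the shifted environment is almost surely good as well, as the harmonic property
  -- requires.
  have hgood2 : ∀ᵐ ω ∂P, (ξ ω).shift.IsGood := ae_of_ae_map hξm.aemeasurable
    (herg.toMeasurePreserving.quasiMeasurePreserving.ae hgood)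
  refine ⟨?_, fun y _ => (Env.measurable_harmonic y).comp (comap_measurable ξ), ?_, ?_⟩
  · filter_upwards [hgood1] with ω hω y hy
    exact ⟨hω.exitTime_ne_top hy, hω.integrable_stoppedValue hy, hω.tendsto_harmonicApprox hy⟩
  · filter_upwards [hgood1, hgood2] with ω hω hω' y hy
    exact hω.harmonic_eq_setIntegral hω' hy
  · filter_upwards [hgood1] with ω hω
    exact ⟨fun y hy => hω.harmonic_pos hy, hω.harmonic_monotoneOn, hω.tendsto_harmonic_div⟩
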